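/- Let $(M,g)$ be a compact connected smooth Riemannian manifold without boundary, and let $p:\widetilde M\to M$ be its universal cover, endowed with the lifted Riemannian metric. For $x\in\widetilde M$ and $r\ge 0$ let $B(x,r)$ be the closed ball of centre $x$ and radius $r$ for the Riemannian distance of $\widetilde M$, let $\nu_x(r)=\operatorname{Vol}B(x,r)$ be its Riemannian volume, and let $$\tau(x)=\inf\Big\{s\ge 0 \;\Big|\; \limsup_{r\to\infty}\frac{1}{r^s}\operatorname{Vol}B(x,r)=0\Big\}\in[0,\infty].$$ Two nondecreasing functions $\alpha_1,\alpha_2:\mathbb R^+\to\mathbb R^+$ are called weakly equivalent, written $\alpha_1\sim\alpha_2$, if there are constants $\lambda,\mu>1$ and $C,C'\ge 0$ such that for all $t\ge 0$ $$\alpha_1(t)\le\lambda\,\alpha_2(\lambda t+C)+C,\qquad \alpha_2(t)\le\mu\,\alpha_1(\mu t+C')+C'.$$ For a group $\Gamma$ and a finite generating set $S$ let $\beta_S(k)$ $(k\in\mathbb N)$ be the number of elements of $\Gamma$ that are products of at most $k$ elements of $S\cup S^{-1}$; put $\beta_S(t)=\beta_S(\lceil t\rceil)$ for real $t\ge 0$.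 Then $\pi_1(M)$ (at any base point) is finitely generated, and for every finite generating set $S$ of $\pi_1(M)$ and every $x\in\widetilde M$: 1. $\nu_x$ (which takes finite values) and $\beta_S$ are weakly equivalent. 2. $\tau(x)$ is the degree of polynomial growth of $\pi_1(M)$, that is, $$\tau(x)=\inf\Big\{s\ge 0 \;\Big|\; \limsup_{t\to\infty}\frac{\beta_S(t)}{t^s}=0\Big\}\in[0,\infty].$$ In particular, $\tau(x)=d$ if $\pi_1(M)$ has polynomial growth of degree $d\ge 0$, i.e. $\beta_S(t)\sim t^d$; and $\tau(x)=\infty$ if $\beta_S$ grows faster than every polynomial (for all $d,C\in\mathbb N$ there is $k\ge 1$ with $\beta_S(k)>C k^d$), and also if $\pi_1(M)$ has exponential growth, i.e. $\limsup_{k\to\infty}\beta_S(k)^{1/k}>1$. Moreover $\tau(x)$ does not depend on $x\in\widetilde M$. Finally, if $M$ is homeomorphic to the torus $\mathbb T^\ell=(\mathbb R/\mathbb Z)^\ell$, $\ell\ge 0$, with any Riemannian metric, then $\tau(x)=\ell$ for all $x\in\widetilde M$; that is, $\tau(\mathbb T^\ell)=\ell$. -/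

import Mathlib

open MeasureTheory Filter Topology Bundle Manifold
open scoped NNReal ENNReal ContDiff

noncomputable section

/-! ### Growth functions -/

/-- Two growth functions are weakly equivalent if each is bounded by the other one, up to
finite multiplicative and additive constants inside and outside. Values are taken in `[0, ∞]`; as
the constants are finite, a function weakly equivalent to a finite-valued one is finite-valued. -/
def WeaklyEquivalent (α₁ α₂ : ℝ≥0 → ℝ≥0∞) : Prop :=
  ∃ lam mu C C' : ℝ≥0, 1 < lam ∧ 1 < mu ∧
    ∀ t : ℝ≥0, α₁ t ≤ lam * α₂ (lam * t + C) + C ∧ α₂ t ≤ mu * α₁ (mu * t + C') + C'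

/-- The polynomial degree of a growth function `α`: the infimum in `[0, ∞]` of the real numbers
`s ≥ 0` with `limsup_{r → ∞} α r / r ^ s = 0` (the infimum of the empty set being `∞`). -/
def polynomialDegree (α : ℝ≥0 → ℝ≥0∞) : ℝ≥0∞ :=
  sInf {s : ℝ≥0∞ | ∃ t : ℝ≥0, s = t ∧
    limsup (fun r : ℝ≥0 => α r / (r : ℝ≥0∞) ^ (t : ℝ)) atTop = 0}

/-- The growth function `t ↦ β ⌈t⌉` attached to a function `β : ℕ → ℕ`. -/
def natGrowth (β : ℕ → ℕ) : ℝ≥0 → ℝ≥0∞ := fun t => (β ⌈t⌉₊ : ℝ≥0∞)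

/-! ### Word growth of groups -/

/-- The word length of `γ` with respect to `S`: the least length of a word in `S ∪ S⁻¹` which
represents `γ` (only used when `S` generates the group). -/
def wordLength {G : Type*} [Group G] (S : Set G) (γ : G) : ℕ :=
  sInf {k : ℕ | ∃ w : List G, w.length = k ∧ (∀ s ∈ w, s ∈ S ∨ s⁻¹ ∈ S) ∧ w.prod = γ}

/-- The word growth function: `wordGrowth S k` is the number of elements of word length at
most `k` (used only when `S` is a finite generating set, so that this number is finite). -/
def wordGrowth {G : Type*} [Group G] (S : Set G) (k : ℕ) : ℕ :=
  {γ : G | wordLength S γ ≤ k}.ncard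

/-- The exponential growth rate `limsup_k (β k) ^ (1 / k)` of the pair `(G, S)`. -/
def exponentialGrowthRate {G : Type*} [Group G] (S : Set G) : ℝ≥0∞ :=
  limsup (fun k : ℕ => (wordGrowth S k : ℝ≥0∞) ^ (1 / (k : ℝ))) atTop

/-- The pair `(G, S)` has polynomial growth of degree `d`. -/
def HasPolynomialGrowth {G : Type*} [Group G] (S : Set G) (d : ℝ≥0) : Prop :=
  WeaklyEquivalent (natGrowth (wordGrowth S)) (fun t => (t : ℝ≥0∞) ^ (d : ℝ))

/-- The pair `(G, S)` grows faster than every polynomial. -/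
def HasSuperpolynomialGrowth {G : Type*} [Group G] (S : Set G) : Prop :=
  ∀ d C : ℕ, ∃ k : ℕ, 1 ≤ k ∧ C * k ^ d < wordGrowth S k

/-! ### Riemannian volume -/

section Volume

variable {n : ℕ} {M : Type*} [EMetricSpace M] [ChartedSpace (EuclideanSpace ℝ (Fin n)) M]
  [RiemannianBundle (fun x : M => TangentSpace (𝓡 n) x)]

/-- The coordinate vector field `∂ᵢ` of the chart at `x₀`, at the point of coordinates `y`. -/
def coordVector (x₀ : M) (y : EuclideanSpace ℝ (Fin n)) (i : Fin n) :
    TangentSpace (𝓡 n) ((chartAt (EuclideanSpace ℝ (Fin n)) x₀).symm y) :=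
  mfderiv (𝓡 n) (𝓡 n) (chartAt (EuclideanSpace ℝ (Fin n)) x₀).symm y
    (EuclideanSpace.single i (1 : ℝ))

/-- The Gram matrix `gᵢⱼ = g(∂ᵢ, ∂ⱼ)` of the Riemannian metric in the chart at `x₀`. -/
def metricMatrix (x₀ : M) (y : EuclideanSpace ℝ (Fin n)) : Matrix (Fin n) (Fin n) ℝ :=
  Matrix.of fun i j => inner ℝ (coordVector x₀ y i) (coordVector x₀ y j)

variable [MeasurableSpace M]

/-- The Riemannian volume on the domain of the chart at `x₀` (extended by zero to the manifold),
that is, the measure `√(det gᵢⱼ) dy₁ ⋯ dyₙ` transported by the chart. -/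
def chartVolume (x₀ : M) : Measure M :=
  Measure.map (chartAt (EuclideanSpace ℝ (Fin n)) x₀).symm
    ((volume.restrict (chartAt (EuclideanSpace ℝ (Fin n)) x₀).target).withDensity
      fun y => ENNReal.ofReal √(metricMatrix x₀ y).det)

variable (n M) in
/-- The Riemannian volume measure: the least measure which dominates the Riemannian volume of
each chart domain. As the volumes of two charts agree on the intersection of their domains,
on a second countable manifold this is the unique measure which restricts to
`√(det gᵢⱼ) dy₁ ⋯ dyₙ` on every chart domain. -/
def riemannianVolume : Measure M :=
  ⨆ x₀ : M, chartVolume (n := n) x₀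

variable (n) in
/-- The volume growth function `r ↦ Vol B(x, r)`, where `B(x, r)` is the closed ball. -/
def volumeGrowth (x : M) (r : ℝ≥0) : ℝ≥0∞ :=
  riemannianVolume n M {y : M | edist y x ≤ r}

variable (n) in
/-- The number `τ(x)`: the infimum of the `s ≥ 0` with `limsup_{r → ∞} Vol B(x, r) / r ^ s = 0`. -/
def volumeDegree (x : M) : ℝ≥0∞ :=
  polynomialDegree (volumeGrowth n x)

end Volume

/-! ### Riemannian coverings -/

/-- A smooth covering map between Riemannian manifolds such that the metric of the total space is
the metric lifted from the base. -/
structure IsRiemannianCovering {n : ℕ}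
    {M' : Type*} [EMetricSpace M'] [ChartedSpace (EuclideanSpace ℝ (Fin n)) M']
    [RiemannianBundle (fun x : M' => TangentSpace (𝓡 n) x)]
    {M : Type*} [EMetricSpace M] [ChartedSpace (EuclideanSpace ℝ (Fin n)) M]
    [RiemannianBundle (fun x : M => TangentSpace (𝓡 n) x)]
    (p : M' → M) : Prop where
  isCoveringMap : IsCoveringMap p
  contMDiff : ContMDiff (𝓡 n) (𝓡 n) ∞ p
  inner_mfderiv : ∀ (x : M') (v w : TangentSpace (𝓡 n) x),
    inner ℝ (mfderiv (𝓡 n) (𝓡 n) p x v) (mfderiv (𝓡 n) (𝓡 n) p x w) = inner ℝ v w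

end

/-! This is the Švarc–Milnor argument. The deck group `Γ` of the universal cover acts on it freely
and by isometries, with compact quotient, and `Γ` is the fundamental group of the base. Fix `x₀` and
measure `g ∈ Γ` by its displacement, the distance from `x₀` to `g • x₀`. Volume growth and word
growth are both compared with the number of `g` of displacement at most `r`.

Volume against orbit points: by cocompactness the translates of a ball of some radius `D` cover the
cover, which bounds the volume of a ball by a multiple of the number of orbit points
(`volumeGrowth_dominated`). Conversely a small open neighbourhood of `x₀` has disjoint translates of
equal positive volume (`dominated_volumeGrowth`). Both need a volume invariant under isometries
(`riemannianVolume_image`) and compact closed balls (`isCompact_closedEBall`).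

Orbit points against words: a word in finitely many generators has displacement linear in its
length. Conversely, a path from `x₀` to `g • x₀` is cut into pieces of length about one and the cut
points are moved to the orbit, which writes `g` as a product of linearly many elements of bounded
displacement (`isGeometricLength_deckLength`). `IsGeometricLength` isolates what this uses and
already gives finite generation and both comparisons.

The polynomial degree is monotone under domination (`polynomialDegree_le_of_growthDominated`), so it
can be read off from either growth function. For the torus the group is `ℤˡ`, whose sup norm is also
a geometric length; counting lattice points in cubes gives degree `l`. -/

noncomputable section

/-! ### Growth functions up to domination, and their polynomial degree -/

section Growth

/-- The growth function `α` is bounded by `β`, up to finite multiplicative and additive constants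
inside and outside. -/
def GrowthDominated (α β : ℝ≥0 → ℝ≥0∞) : Prop :=
  ∃ A : ℝ≥0, ∀ t, α t ≤ A * β (A * t + A) + A

variable {α β γ : ℝ≥0 → ℝ≥0∞}

/-- Since `β` is monotone, all four constants may be enlarged to their sum, which leaves a single
constant to carry around. -/
lemma GrowthDominated.of_le (hβ : Monotone β) (a b c d : ℝ≥0)
    (h : ∀ t, α t ≤ a * β (b * t + c) + d) : GrowthDominated α β := by
  have hle : ∀ {x : ℝ≥0}, x ≤ a + b + c + d → (x : ℝ≥0∞) ≤ (a + b + c + d : ℝ≥0) :=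
    fun h => by exact_mod_cast h
  have hr : ∀ {x : ℝ≥0}, (x : ℝ) ≤ a + b + c + d → x ≤ a + b + c + d := fun h => by
    rw [← NNReal.coe_le_coe]; push_cast; exact h
  have ha := a.coe_nonneg
  have hb := b.coe_nonneg
  have hc := c.coe_nonneg
  have hd := d.coe_nonneg
  refine ⟨a + b + c + d, fun t => (h t).trans ?_⟩
  exact add_le_add (mul_le_mul' (hle (hr (by linarith)))
    (hβ (add_le_add (mul_le_mul' (hr (by linarith)) le_rfl) (hr (by linarith)))))
    (hle (hr (by linarith)))

lemma GrowthDominated.trans (hγ : Monotone γ) (h₁ : GrowthDominated α β)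
    (h₂ : GrowthDominated β γ) : GrowthDominated α γ := by
  obtain ⟨A, hA⟩ := h₁
  obtain ⟨B, hB⟩ := h₂
  refine .of_le hγ (A * B) (B * A) (B * A + B) (A * B + A) fun t => (hA t).trans ?_
  calc (A : ℝ≥0∞) * β (A * t + A) + A ≤ A * (B * γ (B * (A * t + A) + B) + B) + A := by
        gcongr; exact hB _
    _ = _ := by
        rw [show B * (A * t + A) + B = B * A * t + (B * A + B) by ring]
        push_cast
        ring

lemma WeaklyEquivalent.of_growthDominated (hα : Monotone α) (hβ : Monotone β)
    (h₁ : GrowthDominated α β) (h₂ : GrowthDominated β α) : WeaklyEquivalent α β := by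
  obtain ⟨A, hA⟩ := h₁
  obtain ⟨B, hB⟩ := h₂
  have hle : ∀ x : ℝ≥0, x ≤ x + 2 := fun x => le_self_add
  have hle' : ∀ x : ℝ≥0, (x : ℝ≥0∞) ≤ (x + 2 : ℝ≥0) := fun x => by exact_mod_cast hle x
  have hlt : ∀ x : ℝ≥0, 1 < x + 2 := fun x => one_lt_two.trans_le le_add_self
  -- Weak equivalence asks for factors greater than one; adding 2 ensures this.
  refine ⟨A + 2, B + 2, A, B, hlt A, hlt B, fun t => ⟨(hA t).trans ?_, (hB t).trans ?_⟩⟩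
  · exact add_le_add (mul_le_mul' (hle' A) (hβ (add_le_add (mul_le_mul' (hle A) le_rfl) le_rfl)))
      le_rfl
  · exact add_le_add (mul_le_mul' (hle' B) (hα (add_le_add (mul_le_mul' (hle B) le_rfl) le_rfl)))
      le_rfl

lemma WeaklyEquivalent.growthDominated (hβ : Monotone β) (h : WeaklyEquivalent α β) :
    GrowthDominated α β := by
  obtain ⟨l, m, C, C', -, -, h⟩ := h
  exact .of_le hβ l l C C fun t => (h t).1

lemma WeaklyEquivalent.growthDominated' (hα : Monotone α) (h : WeaklyEquivalent α β) :
    GrowthDominated β α := by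
  obtain ⟨l, m, C, C', -, -, h⟩ := h
  exact .of_le hα m m C' C' fun t => (h t).2

/-- The exponent `t` itself need not give limsup zero, but every `t + ε` does, and the degree is an
infimum. -/
lemma polynomialDegree_le_of_eventually_le {t K : ℝ≥0}
    (h : ∀ᶠ r : ℝ≥0 in atTop, α r ≤ K * (r : ℝ≥0∞) ^ (t : ℝ)) : polynomialDegree α ≤ t := by
  refine ENNReal.le_of_forall_pos_le_add fun ε hε _ => ?_
  refine sInf_le ⟨t + ε, by push_cast; rfl, Tendsto.limsup_eq ?_⟩
  have hlim : Tendsto (fun r : ℝ≥0 => (K : ℝ≥0∞) * (r : ℝ≥0∞) ^ (-(ε : ℝ))) atTop (𝓝 0) := by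
    have h1 : Tendsto (fun r : ℝ≥0 => K * r ^ (-(ε : ℝ))) atTop (𝓝 (K * 0)) :=
      (tendsto_const_nhds (x := K)).mul <| by
        rw [← NNReal.tendsto_coe]
        exact (tendsto_rpow_neg_atTop (NNReal.coe_pos.2 hε)).comp
          (NNReal.tendsto_coe_atTop.2 tendsto_id)
    rw [mul_zero] at h1
    refine (ENNReal.tendsto_coe.2 h1).congr' ?_
    filter_upwards [eventually_gt_atTop 0] with r hr
    rw [ENNReal.coe_mul, ENNReal.coe_rpow_of_ne_zero hr.ne']
  refine tendsto_of_tendsto_of_tendsto_of_le_of_le' tendsto_const_nhds hlim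
    (Eventually.of_forall fun _ => zero_le) ?_
  filter_upwards [h, eventually_gt_atTop 0] with r hr hr0
  have hr0' : (r : ℝ≥0∞) ≠ 0 := by simpa using hr0.ne'
  refine ENNReal.div_le_of_le_mul (hr.trans (le_of_eq ?_))
  rw [mul_assoc, ← ENNReal.rpow_add _ _ hr0' ENNReal.coe_ne_top]
  push_cast
  ring_nf

lemma eventually_le_rpow_of_polynomialDegree_lt {t : ℝ≥0} (h : polynomialDegree α < t) :
    ∀ᶠ r : ℝ≥0 in atTop, α r ≤ (r : ℝ≥0∞) ^ (t : ℝ) := by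
  obtain ⟨_, ⟨s, rfl, hs⟩, hst⟩ := sInf_lt_iff.1 h
  have hst' : (s : ℝ) ≤ t := by exact_mod_cast hst.le
  have := eventually_lt_of_limsup_lt (hs.trans_lt one_pos)
  filter_upwards [this, eventually_ge_atTop 1] with r hr hr1
  have hr1' : (1 : ℝ≥0∞) ≤ r := by exact_mod_cast hr1
  have hr0 : (r : ℝ≥0∞) ≠ 0 := (one_pos.trans_le hr1').ne'
  refine le_trans ?_ (ENNReal.rpow_le_rpow_of_exponent_le hr1' hst')
  have h2 := (ENNReal.div_le_iff (ENNReal.rpow_pos (one_pos.trans_le hr1') ENNReal.coe_ne_top).ne'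
    (ENNReal.rpow_ne_top_of_nonneg s.2 ENNReal.coe_ne_top)).1 hr.le
  simpa using h2

lemma polynomialDegree_le_of_growthDominated (h : GrowthDominated α β) :
    polynomialDegree α ≤ polynomialDegree β := by
  obtain ⟨A, hA⟩ := h
  refine le_of_forall_gt_imp_ge_of_dense fun a ha => ?_
  induction a with
  | top => exact le_top
  | coe t =>
  -- For `r ≥ 1`, `A * r + A ≤ (A + A) * r` and the additive `A` is at most `A * r ^ t`. The case `A
  -- = 0` is separate because `A * r + A` must tend to infinity.
  refine polynomialDegree_le_of_eventually_le (K := A * (A + A) ^ (t : ℝ) + A) ?_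
  rcases eq_or_ne A 0 with rfl | hA0
  · refine Eventually.of_forall fun r => (hA r).trans (by simp)
  have hlim : Tendsto (fun r : ℝ≥0 => A * r + A) atTop atTop :=
    tendsto_atTop_mono (fun r => le_self_add)
      (tendsto_id.const_mul_atTop (pos_iff_ne_zero.2 hA0))
  filter_upwards [hlim.eventually (eventually_le_rpow_of_polynomialDegree_lt ha),
    eventually_ge_atTop 1] with r hr hr1
  have h1 : ((A * r + A : ℝ≥0) : ℝ≥0∞) ≤ ((A + A : ℝ≥0) : ℝ≥0∞) * r := by
    have : A * r + A ≤ (A + A) * r := by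
      rw [add_mul]
      exact add_le_add le_rfl (le_mul_of_one_le_right' hr1)
    exact_mod_cast this
  have h2 : (1 : ℝ≥0∞) ≤ (r : ℝ≥0∞) ^ (t : ℝ) :=
    (ENNReal.one_rpow t).symm.le.trans
      (ENNReal.rpow_le_rpow (by exact_mod_cast hr1) t.coe_nonneg)
  have h3 : ((A + A : ℝ≥0) : ℝ≥0∞) ^ (t : ℝ) = (((A + A) ^ (t : ℝ) : ℝ≥0) : ℝ≥0∞) :=
    (ENNReal.coe_rpow_of_nonneg _ t.coe_nonneg).symm
  calc α r ≤ A * β (A * r + A) + A := hA r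
    _ ≤ A * (((A + A : ℝ≥0) : ℝ≥0∞) * r) ^ (t : ℝ) + A * (r : ℝ≥0∞) ^ (t : ℝ) := by
        refine add_le_add (mul_le_mul' le_rfl (hr.trans (ENNReal.rpow_le_rpow h1 t.coe_nonneg))) ?_
        exact le_mul_of_one_le_right' h2
    _ = _ := by
        rw [ENNReal.mul_rpow_of_nonneg _ _ t.coe_nonneg, h3]
        push_cast
        ring

lemma polynomialDegree_rpow (d : ℝ≥0) :
    polynomialDegree (fun t => (t : ℝ≥0∞) ^ (d : ℝ)) = d := by
  refine le_antisymm (polynomialDegree_le_of_eventually_le (K := 1)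
    (Eventually.of_forall fun r => by simp)) (le_of_not_gt fun h => ?_)
  obtain ⟨s, hs, hsd⟩ := ENNReal.lt_iff_exists_nnreal_btwn.1 h
  obtain ⟨r, hr, hr1⟩ := ((eventually_le_rpow_of_polynomialDegree_lt hs).and
    (eventually_gt_atTop 1)).exists
  have hr1' : (1 : ℝ≥0∞) < r := by exact_mod_cast hr1
  exact absurd hr (not_le.2 (ENNReal.rpow_lt_rpow_of_exponent_lt hr1' ENNReal.coe_ne_top
    (by exact_mod_cast hsd)))

lemma polynomialDegree_eq_of_growthDominated (h₁ : GrowthDominated α β)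
    (h₂ : GrowthDominated β α) : polynomialDegree α = polynomialDegree β :=
  le_antisymm (polynomialDegree_le_of_growthDominated h₁) (polynomialDegree_le_of_growthDominated h₂)

lemma monotone_coe_rpow (d : ℝ≥0) : Monotone fun t : ℝ≥0 => (t : ℝ≥0∞) ^ (d : ℝ) :=
  fun _ _ h => ENNReal.rpow_le_rpow (by exact_mod_cast h) d.2

lemma monotone_natGrowth {b : ℕ → ℕ} (hb : Monotone b) : Monotone (natGrowth b) :=
  fun _ _ h => by
    unfold natGrowth
    exact_mod_cast hb (Nat.ceil_mono h)

/-- A function which is not bounded by any polynomial has infinite polynomial degree. -/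
lemma polynomialDegree_natGrowth_eq_top {b : ℕ → ℕ}
    (h : ∀ d C : ℕ, ∃ k : ℕ, 1 ≤ k ∧ C * k ^ d < b k) :
    polynomialDegree (natGrowth b) = ⊤ := by
  by_contra htop
  obtain ⟨t, ht, -⟩ := ENNReal.lt_iff_exists_nnreal_btwn.1 (lt_top_iff_ne_top.2 htop)
  obtain ⟨r₀, hr₀⟩ := eventually_atTop.1 (eventually_le_rpow_of_polynomialDegree_lt ht)
  set N := ⌈r₀⌉₊
  -- With this `C` the witness `k` cannot be below `N`, because `C` exceeds each of those values;
  -- beyond `N`, `C ≥ 1` contradicts the polynomial bound.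
  set C := ∑ i ∈ Finset.range N, b i + 1
  obtain ⟨k, hk1, hk⟩ := h ⌈t⌉₊ C
  have hpow : 1 ≤ k ^ ⌈t⌉₊ := Nat.one_le_pow _ _ hk1
  rcases lt_or_ge k N with hkN | hkN
  · have h1 : b k ≤ ∑ i ∈ Finset.range N, b i :=
      Finset.single_le_sum (f := b) (fun _ _ => Nat.zero_le _) (Finset.mem_range.2 hkN)
    have h2 : C ≤ C * k ^ ⌈t⌉₊ := Nat.le_mul_of_pos_right _ hpow
    omega
  · have h1 := hr₀ k ((Nat.le_ceil r₀).trans (by exact_mod_cast hkN))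
    have h2 : (((k : ℝ≥0) : ℝ≥0∞)) ^ (t : ℝ) ≤ ((k ^ ⌈t⌉₊ : ℕ) : ℝ≥0∞) := by
      refine (ENNReal.rpow_le_rpow_of_exponent_le (z := ((⌈t⌉₊ : ℕ) : ℝ))
        (by exact_mod_cast hk1) (by exact_mod_cast Nat.le_ceil t)).trans ?_
      rw [ENNReal.rpow_natCast]
      push_cast
      rfl
    have h3 : b k ≤ k ^ ⌈t⌉₊ := by
      have := h1.trans h2
      simp only [natGrowth, Nat.ceil_natCast] at this
      exact_mod_cast this
    have h4 : k ^ ⌈t⌉₊ ≤ C * k ^ ⌈t⌉₊ := Nat.le_mul_of_pos_left _ (Nat.succ_pos _)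
    omega

/-- A polynomially bounded function has exponential growth rate at most one. -/
lemma limsup_rpow_inv_le_one {b : ℕ → ℕ} {d C : ℕ} (h : ∀ k : ℕ, 1 ≤ k → b k ≤ C * k ^ d) :
    limsup (fun k : ℕ => (b k : ℝ≥0∞) ^ (1 / (k : ℝ))) atTop ≤ 1 := by
  -- `C + 1` replaces `C` so that the base is nonzero and its `k`-th root tends to 1.
  have h1 : Tendsto (fun k : ℕ => ((C : ℝ) + 1) ^ (1 / (k : ℝ)) * ((k : ℝ) ^ (1 / (k : ℝ))) ^ d)
      atTop (𝓝 (((C : ℝ) + 1) ^ (0 : ℝ) * 1 ^ d)) := by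
    refine Tendsto.mul ?_ (((tendsto_rpow_div).comp tendsto_natCast_atTop_atTop).pow d)
    exact (tendsto_const_nhds (x := (C : ℝ) + 1)).rpow
      (tendsto_one_div_atTop_nhds_zero_nat) (Or.inl (by positivity))
  rw [Real.rpow_zero, one_pow, one_mul] at h1
  have h2 := (ENNReal.tendsto_ofReal h1).limsup_eq
  rw [ENNReal.ofReal_one] at h2
  rw [← h2]
  refine limsup_le_limsup ?_
  filter_upwards [eventually_ge_atTop 1] with k hk
  have hexp : 0 ≤ 1 / (k : ℝ) := by positivity
  have h3 : (b k : ℝ) ≤ ((C : ℝ) + 1) * (k : ℝ) ^ d := by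
    have : (b k : ℝ) ≤ (C : ℝ) * (k : ℝ) ^ d := by exact_mod_cast h k hk
    refine this.trans ?_
    gcongr
    linarith
  have h4 := Real.rpow_le_rpow (Nat.cast_nonneg (b k)) h3 hexp
  rw [Real.mul_rpow (by positivity) (by positivity), ← Real.rpow_natCast (k : ℝ) d,
    ← Real.rpow_mul (by positivity), mul_comm (d : ℝ), Real.rpow_mul (by positivity),
    Real.rpow_natCast] at h4
  have h5 : (b k : ℝ≥0∞) ^ (1 / (k : ℝ)) = ENNReal.ofReal ((b k : ℝ) ^ (1 / (k : ℝ))) := by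
    rw [← ENNReal.ofReal_rpow_of_nonneg (Nat.cast_nonneg _) hexp, ENNReal.ofReal_natCast]
  rw [h5]
  exact ENNReal.ofReal_le_ofReal h4

end Growth

/-! ### Word length and word growth -/

section WordLength

variable {G : Type*} [Group G] {S : Set G}

/-- Generation makes the set of lengths nonempty, so the infimum is attained and is not the default
value 0. -/
lemma exists_word_of_closure_eq_top (hS : Subgroup.closure S = ⊤) (γ : G) :
    ∃ w : List G, w.length = wordLength S γ ∧ (∀ s ∈ w, s ∈ S ∨ s⁻¹ ∈ S) ∧ w.prod = γ := by
  have hγ : γ ∈ (Subgroup.closure S).toSubmonoid := by rw [hS]; trivial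
  rw [Subgroup.closure_toSubmonoid] at hγ
  obtain ⟨w, hw, hprod⟩ := Submonoid.exists_list_of_mem_closure hγ
  exact Nat.sInf_mem (s := {k : ℕ | ∃ w : List G, w.length = k ∧
    (∀ s ∈ w, s ∈ S ∨ s⁻¹ ∈ S) ∧ w.prod = γ}) ⟨_, w, rfl, hw, hprod⟩

lemma wordLength_le {w : List G} (hw : ∀ s ∈ w, s ∈ S ∨ s⁻¹ ∈ S) :
    wordLength S w.prod ≤ w.length :=
  Nat.sInf_le ⟨w, rfl, hw, rfl⟩

lemma wordLength_one : wordLength S 1 = 0 :=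
  Nat.le_zero.1 (wordLength_le (S := S) (w := []) (by simp))

lemma wordLength_mul_le (hS : Subgroup.closure S = ⊤) (g h : G) :
    wordLength S (g * h) ≤ wordLength S g + wordLength S h := by
  obtain ⟨v, hv, hvS, hvp⟩ := exists_word_of_closure_eq_top hS g
  obtain ⟨w, hw, hwS, hwp⟩ := exists_word_of_closure_eq_top hS h
  rw [← hv, ← hw, ← List.length_append, ← hvp, ← hwp, ← List.prod_append]
  refine wordLength_le fun s hs => ?_
  rcases List.mem_append.1 hs with h | h
  exacts [hvS s h, hwS s h]

/-- Removing the first letter places the ball of radius `k + 1` in the ball of radius `k` together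
with its translates by the finitely many letters. -/
lemma finite_wordLength_le (hS : Subgroup.closure S = ⊤) (hfin : S.Finite) (k : ℕ) :
    {γ : G | wordLength S γ ≤ k}.Finite := by
  induction k with
  | zero =>
    refine (Set.finite_singleton (1 : G)).subset fun γ hγ => ?_
    obtain ⟨w, hw, -, rfl⟩ := exists_word_of_closure_eq_top hS γ
    have : w = [] := List.length_eq_zero_iff.1 (hw.trans (Nat.le_zero.1 hγ))
    simp [this]
  | succ k ih =>
    have hT : (S ∪ S⁻¹).Finite := hfin.union hfin.inv
    refine (ih.union (hT.mul ih)).subset fun γ hγ => ?_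
    obtain ⟨w, hw, hwS, rfl⟩ := exists_word_of_closure_eq_top hS γ
    match w, hw, hwS with
    | [], _, _ => exact Or.inl (by simp [wordLength_one])
    | s :: v, hw, hwS =>
      refine Or.inr (Set.mem_mul.2 ⟨s, ?_, v.prod, ?_, by simp⟩)
      · exact hwS s (by simp)
      · have h1 := wordLength_le (S := S) (w := v) fun s hs => hwS s (by simp [hs])
        have h2 : wordLength S (s :: v).prod ≤ k + 1 := hγ
        rw [List.length_cons] at hw
        exact h1.trans (by omega)

lemma monotone_wordGrowth (hS : Subgroup.closure S = ⊤) (hfin : S.Finite) :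
    Monotone (wordGrowth S) := fun _ _ h =>
  Set.ncard_le_ncard (fun _ hγ => le_trans hγ h) (finite_wordLength_le hS hfin _)

end WordLength

/-! ### Geometric lengths: the algebraic half of the Švarc–Milnor argument -/

/-- A proper length function on a group for which every element is a product of boundedly long
elements, in a number which is linearly bounded by its length. -/
structure IsGeometricLength {G : Type*} [Group G] (ℓ : G → ℝ≥0) : Prop where
  map_one : ℓ 1 = 0
  map_mul_le : ∀ g h, ℓ (g * h) ≤ ℓ g + ℓ h
  map_inv : ∀ g, ℓ g⁻¹ = ℓ g
  finite_le : ∀ r, {g | ℓ g ≤ r}.Finite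
  exists_word : ∃ R : ℝ≥0, ∀ (k : ℕ) (g : G), ℓ g ≤ k →
    ∃ w : List G, w.length ≤ k + 1 ∧ (∀ s ∈ w, ℓ s ≤ R) ∧ w.prod = g

/-- The number of elements of length at most `r`. -/
def lengthGrowth {G : Type*} (ℓ : G → ℝ≥0) (r : ℝ≥0) : ℝ≥0∞ :=
  ({g | ℓ g ≤ r}.ncard : ℝ≥0∞)

lemma lengthGrowth_comp_mulEquiv {G H : Type*} [Mul G] [Mul H] (ℓ : G → ℝ≥0) (φ : H ≃* G) :
    lengthGrowth (ℓ ∘ φ) = lengthGrowth ℓ := by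
  ext r
  have h : {g | ℓ g ≤ r} = φ '' {h | (ℓ ∘ φ) h ≤ r} := by
    ext g
    simp only [Function.comp, Set.mem_image, Set.mem_ofPred_eq]
    exact ⟨fun h => ⟨φ.symm g, by simpa using h, by simp⟩, by rintro ⟨h, hh, rfl⟩; exact hh⟩
  rw [lengthGrowth, lengthGrowth, h, Set.ncard_image_of_injective _ φ.injective]

namespace IsGeometricLength

variable {G : Type*} [Group G] {ℓ : G → ℝ≥0} (hℓ : IsGeometricLength ℓ)
include hℓ

lemma comp_mulEquiv {H : Type*} [Group H] (φ : H ≃* G) : IsGeometricLength (ℓ ∘ φ) where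
  map_one := by simp [hℓ.map_one]
  map_mul_le g h := by simpa using hℓ.map_mul_le (φ g) (φ h)
  map_inv g := by simpa using hℓ.map_inv (φ g)
  finite_le r := (hℓ.finite_le r).preimage φ.injective.injOn
  exists_word := by
    obtain ⟨R, hR⟩ := hℓ.exists_word
    refine ⟨R, fun k g hg => ?_⟩
    obtain ⟨w, hw, hwR, hwg⟩ := hR k (φ g) hg
    refine ⟨w.map φ.symm, by simpa using hw, ?_, ?_⟩
    · simpa using hwR
    · rw [← map_list_prod, hwg, φ.symm_apply_apply]

lemma monotone_lengthGrowth : Monotone (lengthGrowth ℓ) := fun _ _ h => by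
  unfold lengthGrowth
  exact_mod_cast Set.ncard_le_ncard (fun g hg => le_trans hg h) (hℓ.finite_le _)

lemma fg : Group.FG G := by
  obtain ⟨R, hR⟩ := hℓ.exists_word
  refine Group.fg_iff.2 ⟨{g | ℓ g ≤ R}, ?_, hℓ.finite_le R⟩
  refine eq_top_iff.2 fun g _ => ?_
  obtain ⟨w, -, hw, rfl⟩ := hR ⌈ℓ g⌉₊ g (Nat.le_ceil _)
  exact Subgroup.list_prod_mem _ fun s hs => Subgroup.subset_closure (hw s hs)

lemma map_list_prod_le {L : ℝ≥0} (w : List G) (hw : ∀ s ∈ w, ℓ s ≤ L) :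
    ℓ w.prod ≤ L * w.length := by
  induction w with
  | nil => simp [hℓ.map_one]
  | cons s v ih =>
    rw [List.prod_cons, List.length_cons, Nat.cast_succ, mul_add, mul_one, add_comm]
    exact (hℓ.map_mul_le _ _).trans (add_le_add (hw s (by simp))
      (ih fun t ht => hw t (by simp [ht])))

variable {S : Set G}

/-- If `L` bounds the length of the generators, `k` letters produce length at most `L * k`; rounding
`t` up costs one more `L`. -/
lemma natGrowth_dominated (hS : Subgroup.closure S = ⊤) (hfin : S.Finite) :
    GrowthDominated (natGrowth (wordGrowth S)) (lengthGrowth ℓ) := by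
  obtain ⟨L, hL⟩ := (hfin.image ℓ).bddAbove
  refine .of_le hℓ.monotone_lengthGrowth 1 L L 0 fun t => ?_
  rw [ENNReal.coe_one, one_mul, ENNReal.coe_zero, add_zero]
  have hsub : {γ | wordLength S γ ≤ ⌈t⌉₊} ⊆ {g | ℓ g ≤ L * t + L} := fun γ hγ => by
    obtain ⟨w, hw, hwS, rfl⟩ := exists_word_of_closure_eq_top hS γ
    have h1 := hℓ.map_list_prod_le w (L := L) fun s hs => by
      rcases hwS s hs with h | h
      · exact hL ⟨s, h, rfl⟩
      · rw [← hℓ.map_inv]; exact hL ⟨_, h, rfl⟩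
    have h2 : (w.length : ℝ≥0) ≤ t + 1 :=
      le_trans (by rw [hw]; exact_mod_cast hγ) (Nat.ceil_lt_add_one (zero_le)).le
    calc ℓ w.prod ≤ L * w.length := h1
      _ ≤ L * (t + 1) := mul_le_mul' le_rfl h2
      _ = L * t + L := by ring
  unfold natGrowth lengthGrowth wordGrowth
  exact_mod_cast Set.ncard_le_ncard hsub (hℓ.finite_le _)

/-- The ball `{ℓ ≤ R}` is finite, so its word lengths have a bound `K`. An element of length at most
`t` is a product of at most `⌈t⌉ + 1 ≤ t + 2` elements of this ball, hence the constant `2 * K`. -/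
lemma dominated_natGrowth (hS : Subgroup.closure S = ⊤) (hfin : S.Finite) :
    GrowthDominated (lengthGrowth ℓ) (natGrowth (wordGrowth S)) := by
  obtain ⟨R, hR⟩ := hℓ.exists_word
  obtain ⟨K, hK⟩ := ((hℓ.finite_le R).image (wordLength S)).bddAbove
  refine .of_le (monotone_natGrowth (monotone_wordGrowth hS hfin)) 1 K (2 * K) 0 fun t => ?_
  rw [ENNReal.coe_one, one_mul, ENNReal.coe_zero, add_zero]
  have hlist : ∀ w : List G, (∀ s ∈ w, ℓ s ≤ R) → wordLength S w.prod ≤ K * w.length := by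
    intro w
    induction w with
    | nil => simp [wordLength_one]
    | cons s v ih =>
      intro hw
      rw [List.prod_cons, List.length_cons, mul_add, mul_one, add_comm]
      exact (wordLength_mul_le hS _ _).trans (add_le_add (hK ⟨s, hw s (by simp), rfl⟩)
        (ih fun t ht => hw t (by simp [ht])))
  have hsub : {g | ℓ g ≤ t} ⊆ {γ | wordLength S γ ≤ ⌈(K : ℝ≥0) * t + 2 * K⌉₊} := fun g hg => by
    obtain ⟨w, hw, hwR, rfl⟩ := hR ⌈t⌉₊ g (le_trans hg (Nat.le_ceil t))
    have h1 : wordLength S w.prod ≤ K * (⌈t⌉₊ + 1) :=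
      (hlist w hwR).trans (Nat.mul_le_mul_left _ hw)
    have h2 : ((K * (⌈t⌉₊ + 1) : ℕ) : ℝ≥0) ≤ (K : ℝ≥0) * t + 2 * K := by
      push_cast
      calc (K : ℝ≥0) * (⌈t⌉₊ + 1) ≤ K * (t + 1 + 1) := by
            gcongr; exact (Nat.ceil_lt_add_one (zero_le)).le
        _ = _ := by ring
    exact h1.trans (by exact_mod_cast h2.trans (Nat.le_ceil _))
  unfold natGrowth lengthGrowth wordGrowth
  exact_mod_cast Set.ncard_le_ncard hsub (finite_wordLength_le hS hfin _)

end IsGeometricLength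

/-! ### The sup norm on `ℤˡ` as a geometric length -/

section IntegerLattice

variable (l : ℕ)

/-- The sup norm on the group `ℤˡ`. -/
def latticeLength (g : Multiplicative (Fin l → ℤ)) : ℝ≥0 := ‖g.toAdd‖₊

variable {l}

lemma latticeLength_le_iff {g : Multiplicative (Fin l → ℤ)} {r : ℝ≥0} :
    latticeLength l g ≤ r ↔ ∀ i, |g.toAdd i| ≤ ⌊r⌋₊ := by
  rw [latticeLength, pi_nnnorm_le_iff]
  refine forall_congr' fun i => ?_
  rw [← NNReal.natCast_natAbs, ← Nat.le_floor_iff (zero_le), Int.abs_eq_natAbs, Nat.cast_le]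

lemma setOf_latticeLength_le (r : ℝ≥0) : {g | latticeLength l g ≤ r} =
    Multiplicative.toAdd ⁻¹' (Finset.Icc (fun _ => -(⌊r⌋₊ : ℤ)) (fun _ => (⌊r⌋₊ : ℤ)) :
      Finset (Fin l → ℤ)) := by
  ext g
  simp only [Set.mem_ofPred_eq, latticeLength_le_iff, abs_le, Set.mem_preimage, Finset.coe_Icc,
    Set.mem_Icc, Pi.le_def, forall_and]

variable (l) in
lemma isGeometricLength_latticeLength : IsGeometricLength (latticeLength l) where
  map_one := by simp [latticeLength]
  map_mul_le g h := by simpa [latticeLength] using nnnorm_add_le g.toAdd h.toAdd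
  map_inv g := by simp [latticeLength]
  finite_le r := by
    rw [setOf_latticeLength_le]
    exact (Finset.finite_toSet _).preimage Multiplicative.toAdd.injective.injOn
  exists_word := by
    refine ⟨1, fun k => ?_⟩
    suffices h : ∀ g, latticeLength l g ≤ k →
        ∃ w : List (Multiplicative (Fin l → ℤ)), w.length ≤ k ∧
          (∀ s ∈ w, latticeLength l s ≤ 1) ∧ w.prod = g by
      intro g hg
      obtain ⟨w, hw, h⟩ := h g hg
      exact ⟨w, hw.trans (Nat.le_succ k), h⟩
    induction k with
    | zero =>
      intro g hg
      refine ⟨[], le_rfl, by simp, ?_⟩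
      have : ‖g.toAdd‖₊ = 0 := by simpa [latticeLength] using hg
      rw [nnnorm_eq_zero] at this
      exact (Multiplicative.toAdd.injective this).symm
    | succ k ih =>
      intro g hg
      rw [latticeLength_le_iff, Nat.floor_natCast] at hg
      -- Subtracting the sign vector, of norm at most one, brings every nonzero coordinate one step
      -- closer to zero simultaneously.
      let s : Fin l → ℤ := fun i => (g.toAdd i).sign
      obtain ⟨w, hw, hw1, hwp⟩ := ih ((Multiplicative.ofAdd s)⁻¹ * g) (by
        rw [latticeLength_le_iff, Nat.floor_natCast]
        intro i
        have hi := hg i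
        simp only [toAdd_mul, toAdd_inv, toAdd_ofAdd, Pi.add_apply, Pi.neg_apply, s]
        rcases lt_trichotomy (g.toAdd i) 0 with h | h | h
        · rw [Int.sign_eq_neg_one_of_neg h]
          rw [abs_of_neg h] at hi
          rw [abs_of_nonpos (by omega)]
          push_cast at hi
          omega
        · rw [h]; simp
        · rw [Int.sign_eq_one_of_pos h]
          rw [abs_of_pos h] at hi
          rw [abs_of_nonneg (by omega)]
          push_cast at hi
          omega)
      refine ⟨Multiplicative.ofAdd s :: w, by simpa using hw, ?_, by simp [hwp]⟩
      intro t ht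
      rcases List.mem_cons.1 ht with rfl | ht
      · rw [latticeLength_le_iff, Nat.floor_one]
        intro i
        simp only [toAdd_ofAdd, s]
        rcases lt_trichotomy (g.toAdd i) 0 with h | h | h
        · simp [Int.sign_eq_neg_one_of_neg h]
        · simp [h]
        · simp [Int.sign_eq_one_of_pos h]
      · exact hw1 t ht

lemma lengthGrowth_latticeLength (r : ℝ≥0) :
    lengthGrowth (latticeLength l) r = (2 * (⌊r⌋₊ : ℝ≥0∞) + 1) ^ l := by
  have h := Set.ncard_preimage_of_injective_subset_range Multiplicative.toAdd.injective
    (s := ((Finset.Icc (fun _ => -(⌊r⌋₊ : ℤ)) (fun _ => (⌊r⌋₊ : ℤ)) :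
      Finset (Fin l → ℤ)) : Set (Fin l → ℤ))) (fun x _ => ⟨Multiplicative.ofAdd x, rfl⟩)
  rw [lengthGrowth, setOf_latticeLength_le, h, Set.ncard_coe_finset, Pi.card_Icc]
  simp only [Int.card_Icc, Finset.prod_const, Finset.card_univ, Fintype.card_fin]
  rw [show (⌊r⌋₊ + 1 - -(⌊r⌋₊ : ℤ)).toNat = 2 * ⌊r⌋₊ + 1 by omega]
  push_cast
  rfl

variable (l) in
-- The count `(2 * ⌊r⌋ + 1) ^ l` lies between `r ^ l` and `(2 * r + 1) ^ l`.
lemma polynomialDegree_latticeLength :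
    polynomialDegree (lengthGrowth (latticeLength l)) = l := by
  have hpow : ∀ r : ℝ≥0, (r : ℝ≥0∞) ^ ((l : ℝ≥0) : ℝ) = (r : ℝ≥0∞) ^ l := fun r => by
    rw [NNReal.coe_natCast, ENNReal.rpow_natCast]
  have h : polynomialDegree (lengthGrowth (latticeLength l)) =
      polynomialDegree fun t => (t : ℝ≥0∞) ^ ((l : ℝ≥0) : ℝ) := by
    refine polynomialDegree_eq_of_growthDominated ?_ ?_
    · refine .of_le (monotone_coe_rpow _) 1 2 1 0 fun t => ?_
      rw [lengthGrowth_latticeLength, hpow, ENNReal.coe_one, one_mul, ENNReal.coe_zero, add_zero]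
      gcongr
      have : 2 * (⌊t⌋₊ : ℝ≥0) + 1 ≤ 2 * t + 1 := by
        gcongr; exact Nat.floor_le (zero_le)
      exact_mod_cast this
    · refine .of_le (isGeometricLength_latticeLength l).monotone_lengthGrowth 1 1 0 0 fun t => ?_
      rw [lengthGrowth_latticeLength, hpow, ENNReal.coe_one, one_mul, ENNReal.coe_zero, add_zero,
        one_mul, add_zero]
      gcongr
      have : t ≤ 2 * (⌊t⌋₊ : ℝ≥0) + 1 := by
        refine (Nat.lt_floor_add_one t).le.trans ?_
        gcongr
        exact le_mul_of_one_le_left (zero_le) one_le_two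
      exact_mod_cast this
  rw [h, polynomialDegree_rpow]
  simp

end IntegerLattice

/-! ### Local isometries in charts -/

/-- A `C¹` map between Riemannian manifolds whose derivative preserves inner products. -/
structure IsLocalRiemannianIsometry {n : ℕ}
    {M' : Type*} [EMetricSpace M'] [ChartedSpace (EuclideanSpace ℝ (Fin n)) M']
    [RiemannianBundle (fun x : M' => TangentSpace (𝓡 n) x)]
    {M : Type*} [EMetricSpace M] [ChartedSpace (EuclideanSpace ℝ (Fin n)) M]
    [RiemannianBundle (fun x : M => TangentSpace (𝓡 n) x)]
    (f : M' → M) : Prop where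
  contMDiff : ContMDiff (𝓡 n) (𝓡 n) 1 f
  inner_mfderiv : ∀ (x : M') (v w : TangentSpace (𝓡 n) x),
    inner ℝ (mfderiv (𝓡 n) (𝓡 n) f x v) (mfderiv (𝓡 n) (𝓡 n) f x w) = inner ℝ v w

section Charts

variable {n : ℕ} {M : Type*} [TopologicalSpace M] [ChartedSpace (EuclideanSpace ℝ (Fin n)) M]
  [IsManifold (𝓡 n) ∞ M]

lemma mdifferentiableAt_chartAt_symm (x : M) {y : EuclideanSpace ℝ (Fin n)}
    (hy : y ∈ (chartAt (EuclideanSpace ℝ (Fin n)) x).target) :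
    MDifferentiableAt (𝓡 n) (𝓡 n) (chartAt (EuclideanSpace ℝ (Fin n)) x).symm y :=
  have : IsManifold (𝓡 n) 1 M := .of_le (n := ∞) (by simp)
  mdifferentiableAt_atlas_symm (chart_mem_atlas _ x) hy

lemma mdifferentiableAt_chartAt (x : M) {z : M}
    (hz : z ∈ (chartAt (EuclideanSpace ℝ (Fin n)) x).source) :
    MDifferentiableAt (𝓡 n) (𝓡 n) (chartAt (EuclideanSpace ℝ (Fin n)) x) z :=
  have : IsManifold (𝓡 n) 1 M := .of_le (n := ∞) (by simp)
  mdifferentiableAt_atlas (chart_mem_atlas _ x) hz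

end Charts

section Volume

variable {n : ℕ} {M : Type*} [EMetricSpace M] [ChartedSpace (EuclideanSpace ℝ (Fin n)) M]
  [RiemannianBundle (fun x : M => TangentSpace (𝓡 n) x)]

/-- All tangent spaces are the same model space, but the inner product depends on the base point, so
moving between equal points needs an explicit transport. -/
lemma inner_tangentSpace_congr {a b : M} (h : a = b) (v w : EuclideanSpace ℝ (Fin n)) :
    inner ℝ (show TangentSpace (𝓡 n) a from v) (show TangentSpace (𝓡 n) a from w) =
      inner ℝ (show TangentSpace (𝓡 n) b from v) (show TangentSpace (𝓡 n) b from w) := by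
  subst h; rfl

lemma inner_mfderiv_congr {g₁ g₂ : EuclideanSpace ℝ (Fin n) → M} {y : EuclideanSpace ℝ (Fin n)}
    (h : g₁ =ᶠ[𝓝 y] g₂) (v w : EuclideanSpace ℝ (Fin n)) :
    inner ℝ (mfderiv (𝓡 n) (𝓡 n) g₁ y v) (mfderiv (𝓡 n) (𝓡 n) g₁ y w) =
      inner ℝ (mfderiv (𝓡 n) (𝓡 n) g₂ y v) (mfderiv (𝓡 n) (𝓡 n) g₂ y w) := by
  have h1 : ∀ u : EuclideanSpace ℝ (Fin n),
      (show EuclideanSpace ℝ (Fin n) from mfderiv (𝓡 n) (𝓡 n) g₁ y u) =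
      (show EuclideanSpace ℝ (Fin n) from mfderiv (𝓡 n) (𝓡 n) g₂ y u) := by
    intro u
    exact congrArg (fun L : EuclideanSpace ℝ (Fin n) →L[ℝ] EuclideanSpace ℝ (Fin n) => L u)
      h.mfderiv_eq
  have h2 := inner_tangentSpace_congr h.eq_of_nhds
    (show EuclideanSpace ℝ (Fin n) from mfderiv (𝓡 n) (𝓡 n) g₁ y v)
    (show EuclideanSpace ℝ (Fin n) from mfderiv (𝓡 n) (𝓡 n) g₁ y w)
  refine h2.trans ?_
  rw [h1 v, h1 w]

/-- The Gram matrix of the vectors `L ∂ᵢ`. -/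
lemma gram_linear_image (x : M) (y : EuclideanSpace ℝ (Fin n))
    (L : EuclideanSpace ℝ (Fin n) →L[ℝ] EuclideanSpace ℝ (Fin n)) :
    (Matrix.of fun i j =>
      inner ℝ (mfderiv (𝓡 n) (𝓡 n) (chartAt (EuclideanSpace ℝ (Fin n)) x).symm y
          (L (EuclideanSpace.single i (1 : ℝ))))
        (mfderiv (𝓡 n) (𝓡 n) (chartAt (EuclideanSpace ℝ (Fin n)) x).symm y
          (L (EuclideanSpace.single j (1 : ℝ)))) : Matrix (Fin n) (Fin n) ℝ).det =
      L.det ^ 2 * (metricMatrix x y).det := by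
  let b := (EuclideanSpace.basisFun (Fin n) ℝ).toBasis
  let A := LinearMap.toMatrix b b (L : EuclideanSpace ℝ (Fin n) →ₗ[ℝ] EuclideanSpace ℝ (Fin n))
  have hA : ∀ i, L (EuclideanSpace.single i (1 : ℝ)) =
      ∑ k, A k i • EuclideanSpace.single k (1 : ℝ) := by
    intro i
    have := b.sum_repr (L (EuclideanSpace.single i (1 : ℝ)))
    rw [← this]
    refine Finset.sum_congr rfl fun k _ => ?_
    simp [A, b, LinearMap.toMatrix_apply]
  have hdet : L.det = A.det := (LinearMap.det_toMatrix b _).symm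
  have key : (Matrix.of fun i j =>
      inner ℝ (mfderiv (𝓡 n) (𝓡 n) (chartAt (EuclideanSpace ℝ (Fin n)) x).symm y
          (L (EuclideanSpace.single i (1 : ℝ))))
        (mfderiv (𝓡 n) (𝓡 n) (chartAt (EuclideanSpace ℝ (Fin n)) x).symm y
          (L (EuclideanSpace.single j (1 : ℝ)))) : Matrix (Fin n) (Fin n) ℝ) =
      A.transpose * metricMatrix x y * A := by
    ext i j
    have hm : ∀ i, mfderiv (𝓡 n) (𝓡 n) (chartAt (EuclideanSpace ℝ (Fin n)) x).symm y
        (L (EuclideanSpace.single i (1 : ℝ))) = ∑ k, A k i • coordVector x y k := by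
      intro i
      rw [hA i]
      refine (map_sum _ _ _).trans (Finset.sum_congr rfl fun k _ => ?_)
      exact map_smul _ _ _
    rw [Matrix.of_apply, hm i, hm j, sum_inner]
    simp_rw [inner_sum, real_inner_smul_left, real_inner_smul_right]
    simp only [Matrix.mul_apply, Matrix.transpose_apply, metricMatrix, Matrix.of_apply,
      Finset.sum_mul]
    rw [Finset.sum_comm]
    refine Finset.sum_congr rfl fun k _ => Finset.sum_congr rfl fun l _ => by ring
  rw [key, Matrix.det_mul, Matrix.det_mul, Matrix.det_transpose, hdet]
  ring

variable [IsManifold (𝓡 n) ∞ M]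

variable {M' : Type*} [EMetricSpace M'] [ChartedSpace (EuclideanSpace ℝ (Fin n)) M']
  [RiemannianBundle (fun x : M' => TangentSpace (𝓡 n) x)] [IsManifold (𝓡 n) ∞ M']

/-- Near `y`, `f ∘ φ.symm = ψ.symm ∘ F` where `F` is `f` read in the charts. As `f` preserves inner
products, the Gram matrix at `y` is that at `F y` conjugated by the derivative of `F`: the Jacobian
is exactly the ratio of the volume densities. -/
lemma IsLocalRiemannianIsometry.hasFDerivAt_chart {f : M → M'}
    (hf : IsLocalRiemannianIsometry (n := n) f) (x : M) (x' : M') {y : EuclideanSpace ℝ (Fin n)}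
    (hy : y ∈ (chartAt (EuclideanSpace ℝ (Fin n)) x).target)
    (hy' : f ((chartAt (EuclideanSpace ℝ (Fin n)) x).symm y) ∈
      (chartAt (EuclideanSpace ℝ (Fin n)) x').source) :
    ∃ L : EuclideanSpace ℝ (Fin n) →L[ℝ] EuclideanSpace ℝ (Fin n),
      HasFDerivAt (fun z => chartAt (EuclideanSpace ℝ (Fin n)) x'
        (f ((chartAt (EuclideanSpace ℝ (Fin n)) x).symm z))) L y ∧
      √(metricMatrix x y).det = |L.det| * √(metricMatrix x' (chartAt (EuclideanSpace ℝ (Fin n)) x'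
        (f ((chartAt (EuclideanSpace ℝ (Fin n)) x).symm y)))).det := by
  set φ := chartAt (EuclideanSpace ℝ (Fin n)) x
  set ψ := chartAt (EuclideanSpace ℝ (Fin n)) x'
  set F : EuclideanSpace ℝ (Fin n) → EuclideanSpace ℝ (Fin n) := fun z => ψ (f (φ.symm z)) with hF
  have dφ := mdifferentiableAt_chartAt_symm x hy
  have df : MDifferentiableAt (𝓡 n) (𝓡 n) f (φ.symm y) :=
    hf.contMDiff.mdifferentiableAt one_ne_zero
  have dg : MDifferentiableAt (𝓡 n) (𝓡 n) (f ∘ φ.symm) y := df.comp y dφ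
  have dψ : MDifferentiableAt (𝓡 n) (𝓡 n) ψ ((f ∘ φ.symm) y) := mdifferentiableAt_chartAt x' hy'
  have dF : MDifferentiableAt (𝓡 n) (𝓡 n) F y := dψ.comp y dg
  have dψs : MDifferentiableAt (𝓡 n) (𝓡 n) ψ.symm (F y) :=
    mdifferentiableAt_chartAt_symm x' (ψ.map_source hy')
  have hev : f ∘ φ.symm =ᶠ[𝓝 y] ψ.symm ∘ F := by
    have : ∀ᶠ z in 𝓝 y, (f ∘ φ.symm) z ∈ ψ.source :=
      dg.continuousAt.eventually (ψ.open_source.mem_nhds hy')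
    filter_upwards [this] with z hz
    exact (ψ.left_inv hz).symm
  refine ⟨fderiv ℝ F y, (mdifferentiableAt_iff_differentiableAt.1 dF).hasFDerivAt, ?_⟩
  have hdet : (metricMatrix x y).det = (fderiv ℝ F y).det ^ 2 * (metricMatrix x' (F y)).det := by
    rw [← gram_linear_image]
    congr 1
    ext i j
    simp only [metricMatrix, Matrix.of_apply]
    have h1 := inner_mfderiv_congr hev (EuclideanSpace.single i (1 : ℝ))
      (EuclideanSpace.single j (1 : ℝ))
    rw [mfderiv_comp y df dφ, mfderiv_comp y dψs dF, mfderiv_eq_fderiv] at h1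
    exact (hf.inner_mfderiv _ _ _).symm.trans h1
  rw [hdet, Real.sqrt_mul (sq_nonneg _), Real.sqrt_sq_eq_abs]

end Volume

/-- The set is split into disjoint pieces, each inside one `V i`, and countable additivity sums the
local inequalities. -/
lemma measure_le_of_locally_le {α : Type*} [MeasurableSpace α] {μ ν : Measure α} {V : ℕ → Set α}
    (hV : ∀ i, MeasurableSet (V i))
    (h : ∀ i A, MeasurableSet A → A ⊆ V i → μ A ≤ ν A) {B : Set α} (hB : MeasurableSet B)
    (hBV : B ⊆ ⋃ i, V i) : μ B ≤ ν B := by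
  have hm : ∀ i, MeasurableSet (B ∩ disjointed V i) := fun i =>
    hB.inter (MeasurableSet.disjointed hV i)
  have hd : Pairwise (Function.onFun Disjoint fun i => B ∩ disjointed V i) := fun i j hij =>
    (disjoint_disjointed V hij).mono Set.inter_subset_right Set.inter_subset_right
  have hBu : B = ⋃ i, B ∩ disjointed V i := by
    rw [← Set.inter_iUnion, iUnion_disjointed, Set.inter_eq_left.2 hBV]
  rw [hBu, measure_iUnion hd hm, measure_iUnion hd hm]
  exact ENNReal.tsum_le_tsum fun i =>
    h i _ (hm i) (Set.inter_subset_right.trans (disjointed_subset V i))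

section ChartVolume

variable {n : ℕ} {M : Type*} [EMetricSpace M] [ChartedSpace (EuclideanSpace ℝ (Fin n)) M]

lemma measurableSet_chart_symm_preimage [MeasurableSpace M] [BorelSpace M] (x : M) {A : Set M} (hA : MeasurableSet A) :
    MeasurableSet ((chartAt (EuclideanSpace ℝ (Fin n)) x).symm ⁻¹' A ∩
        (chartAt (EuclideanSpace ℝ (Fin n)) x).target) := by
  set φ := chartAt (EuclideanSpace ℝ (Fin n)) x
  have hT : MeasurableSet φ.target := φ.open_target.measurableSet
  have h1 := (continuousOn_iff_continuous_domRestrict.1 φ.continuousOn_symm).measurable hA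
  have h2 := hT.subtype_image h1
  convert h2 using 1
  ext y
  simp [and_comm]

variable [RiemannianBundle (fun x : M => TangentSpace (𝓡 n) x)]

lemma isLocalRiemannianIsometry_id : IsLocalRiemannianIsometry (n := n) (id : M → M) :=
  ⟨contMDiff_id, fun x v w => by rw [mfderiv_id]; rfl⟩

variable [MeasurableSpace M] [BorelSpace M]

lemma chartVolume_apply (x : M) {A : Set M} (hA : MeasurableSet A) :
    chartVolume (n := n) x A =
      ∫⁻ y in (chartAt (EuclideanSpace ℝ (Fin n)) x).symm ⁻¹' A ∩
        (chartAt (EuclideanSpace ℝ (Fin n)) x).target, ENNReal.ofReal √(metricMatrix x y).det := by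
  set φ := chartAt (EuclideanSpace ℝ (Fin n)) x
  have hT : MeasurableSet φ.target := φ.open_target.measurableSet
  have hae : AEMeasurable φ.symm ((volume.restrict φ.target).withDensity
      fun y => ENNReal.ofReal √(metricMatrix x y).det) :=
    (φ.continuousOn_symm.aemeasurable hT).mono_ac (withDensity_absolutelyContinuous _ _)
  rw [chartVolume, Measure.map_apply_of_aemeasurable hae hA, withDensity_apply',
    Measure.restrict_restrict' hT]

lemma chartVolume_inter_source (x : M) {A : Set M} (hA : MeasurableSet A) :
    chartVolume (n := n) x (A ∩ (chartAt (EuclideanSpace ℝ (Fin n)) x).source) =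
      chartVolume (n := n) x A := by
  rw [chartVolume_apply x hA, chartVolume_apply x
    (hA.inter (chartAt (EuclideanSpace ℝ (Fin n)) x).open_source.measurableSet)]
  congr 2
  ext y
  simp only [Set.mem_inter_iff, Set.mem_preimage]
  exact ⟨fun h => ⟨h.1.1, h.2⟩, fun h => ⟨⟨h.1, (chartAt _ x).map_target h.2⟩, h.2⟩⟩

end ChartVolume

/-! ### The Riemannian volume: chart independence, invariance, positivity, local finiteness -/

section Volume

variable {n : ℕ} {M : Type*} [EMetricSpace M] [ChartedSpace (EuclideanSpace ℝ (Fin n)) M]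
  [IsManifold (𝓡 n) ∞ M] [RiemannianBundle (fun x : M => TangentSpace (𝓡 n) x)]

lemma metricMatrix_det_pos (x : M) {y : EuclideanSpace ℝ (Fin n)}
    (hy : y ∈ (chartAt (EuclideanSpace ℝ (Fin n)) x).target) : 0 < (metricMatrix x y).det := by
  have : IsManifold (𝓡 n) 1 M := .of_le (n := ∞) (by simp)
  have hinj := (mdifferentiable_chart (I := 𝓡 n) x).symm.mfderiv_injective hy
  have hli : LinearIndependent ℝ (coordVector x y) := by
    have hb := (EuclideanSpace.basisFun (Fin n) ℝ).toBasis.linearIndependent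
    have := LinearIndependent.map' (R := ℝ) (M := TangentSpace (𝓡 n) y)
      (M' := TangentSpace (𝓡 n) ((chartAt (EuclideanSpace ℝ (Fin n)) x).symm y)) hb
      (mfderiv (𝓡 n) (𝓡 n) (chartAt (EuclideanSpace ℝ (Fin n)) x).symm y).toLinearMap
      (LinearMap.ker_eq_bot.2 hinj)
    have he : coordVector x y =
        (mfderiv (𝓡 n) (𝓡 n) (chartAt (EuclideanSpace ℝ (Fin n)) x).symm y).toLinearMap ∘
          (EuclideanSpace.basisFun (Fin n) ℝ).toBasis := by
      ext1 i
      have hi : (EuclideanSpace.basisFun (Fin n) ℝ).toBasis i =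
          EuclideanSpace.single i (1 : ℝ) := by simp
      exact congrArg (mfderiv (𝓡 n) (𝓡 n) (chartAt (EuclideanSpace ℝ (Fin n)) x).symm y) hi.symm
    rw [he]
    exact this
  exact (Matrix.posDef_gram_of_linearIndependent (𝕜 := ℝ) hli).det_pos

/-- The coordinate fields are continuous sections, being images of constant fields under the tangent
map of the inverse chart; the metric is continuous on them. -/
lemma continuousOn_metricMatrix_det
    [IsContMDiffRiemannianBundle (𝓡 n) ∞ (EuclideanSpace ℝ (Fin n))
      (fun x : M => TangentSpace (𝓡 n) x)] (x : M) :
    ContinuousOn (fun y => (metricMatrix x y).det)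
      (chartAt (EuclideanSpace ℝ (Fin n)) x).target := by
  have : IsManifold (𝓡 n) 1 M := .of_le (n := ∞) (by simp)
  have : IsContMDiffRiemannianBundle (𝓡 n) 0 (EuclideanSpace ℝ (Fin n))
      (fun x : M => TangentSpace (𝓡 n) x) := .of_le (n := ∞) (by simp)
  set φ := chartAt (EuclideanSpace ℝ (Fin n)) x
  have hφ : ContMDiffOn (𝓡 n) (𝓡 n) 1 φ.symm φ.target := contMDiffOn_chart_symm
  have ht := hφ.continuousOn_tangentMapWithin le_rfl φ.open_target.uniqueMDiffOn
  have hc : ∀ i : Fin n, ContinuousOn (fun y => (⟨φ.symm y, coordVector x y i⟩ :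
      TotalSpace (EuclideanSpace ℝ (Fin n)) (fun x : M => TangentSpace (𝓡 n) x))) φ.target := by
    intro i
    have hs : Continuous (fun y : EuclideanSpace ℝ (Fin n) =>
        (⟨y, EuclideanSpace.single i (1 : ℝ)⟩ :
          TangentBundle (𝓡 n) (EuclideanSpace ℝ (Fin n)))) := by
      have := (tangentBundleModelSpaceHomeomorph (𝓡 n)).symm.continuous
      rw [tangentBundleModelSpaceHomeomorph_coe_symm] at this
      exact this.comp (Continuous.prodMk continuous_id continuous_const)
    refine (ht.comp hs.continuousOn fun y hy => hy).congr fun y hy => ?_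
    simp only [Function.comp, tangentMapWithin, coordVector]
    rw [mfderivWithin_of_isOpen φ.open_target hy]
  have hentry : ∀ i j, ContinuousOn (fun y => metricMatrix x y i j) φ.target := by
    intro i j
    have h := ContMDiffOn.inner_bundle (IM := 𝓡 n) (IB := 𝓡 n) (n := 0)
      (F := EuclideanSpace ℝ (Fin n)) (E := fun x : M => TangentSpace (𝓡 n) x)
      (b := φ.symm) (v := fun y => coordVector x y i) (w := fun y => coordVector x y j)
      (s := φ.target) (contMDiffOn_zero_iff.2 (hc i)) (contMDiffOn_zero_iff.2 (hc j))
    exact h.continuousOn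
  have : ContinuousOn (fun y => metricMatrix x y) φ.target :=
    continuousOn_pi.2 fun i => continuousOn_pi.2 fun j => hentry i j
  exact (Continuous.matrix_det continuous_id).comp_continuousOn this

variable [MeasurableSpace M] [BorelSpace M]

/-- Change of variables for `f` read in the charts, the Jacobian being given by `hasFDerivAt_chart`.
The case `f = id` is the independence of the chart. -/
lemma chartVolume_image {f : M → M} (hf : IsLocalRiemannianIsometry (n := n) f)
    (hinj : Function.Injective f) (x x' : M) {A : Set M} (hA : MeasurableSet A)
    (hfA : MeasurableSet (f '' A))
    (h : A ⊆ (chartAt (EuclideanSpace ℝ (Fin n)) x).source)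
    (h' : f '' A ⊆ (chartAt (EuclideanSpace ℝ (Fin n)) x').source) :
    chartVolume (n := n) x' (f '' A) = chartVolume (n := n) x A := by
  rw [chartVolume_apply x hA, chartVolume_apply x' hfA]
  set φ := chartAt (EuclideanSpace ℝ (Fin n)) x
  set ψ := chartAt (EuclideanSpace ℝ (Fin n)) x'
  set F : EuclideanSpace ℝ (Fin n) → EuclideanSpace ℝ (Fin n) := fun z => ψ (f (φ.symm z)) with hF
  set s := φ.symm ⁻¹' A ∩ φ.target
  have hs : MeasurableSet s := measurableSet_chart_symm_preimage x hA
  have hmem : ∀ y ∈ s, f (φ.symm y) ∈ ψ.source := fun y hy => h' ⟨_, hy.1, rfl⟩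
  have himg : ψ.symm ⁻¹' (f '' A) ∩ ψ.target = F '' s := by
    ext z
    constructor
    · rintro ⟨⟨a, ha, hz⟩, hzt⟩
      refine ⟨φ a, ⟨?_, φ.map_source (h ha)⟩, ?_⟩
      · simpa [φ.left_inv (h ha)] using ha
      · simp only [hF, φ.left_inv (h ha), hz, ψ.right_inv hzt]
    · rintro ⟨y, hy, rfl⟩
      refine ⟨⟨φ.symm y, hy.1, (ψ.left_inv (hmem y hy)).symm⟩, ψ.map_source (hmem y hy)⟩
  have hd : ∀ y : EuclideanSpace ℝ (Fin n),
      ∃ L : EuclideanSpace ℝ (Fin n) →L[ℝ] EuclideanSpace ℝ (Fin n), y ∈ s →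
      HasFDerivAt F L y ∧ √(metricMatrix x y).det = |L.det| * √(metricMatrix x' (F y)).det := by
    intro y
    by_cases hy : y ∈ s
    · obtain ⟨L, h1, h2⟩ := hf.hasFDerivAt_chart x x' hy.2 (hmem y hy)
      exact ⟨L, fun _ => ⟨h1, h2⟩⟩
    · exact ⟨0, fun h => absurd h hy⟩
  choose L hL using hd
  have hFinj : Set.InjOn F s := by
    intro a ha b hb hab
    exact φ.symm.injOn ha.2 hb.2 (hinj (ψ.injOn (hmem a ha) (hmem b hb) hab))
  rw [himg, lintegral_image_eq_lintegral_abs_det_fderiv_mul volume hs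
    (fun y hy => (hL y hy).1.hasFDerivWithinAt) hFinj]
  refine setLIntegral_congr_fun hs fun y hy => ?_
  rw [(hL y hy).2, ENNReal.ofReal_mul (abs_nonneg _)]

lemma chartVolume_eq (x x' : M) {A : Set M} (hA : MeasurableSet A)
    (h : A ⊆ (chartAt (EuclideanSpace ℝ (Fin n)) x).source)
    (h' : A ⊆ (chartAt (EuclideanSpace ℝ (Fin n)) x').source) :
    chartVolume (n := n) x' A = chartVolume (n := n) x A := by
  simpa using chartVolume_image (isLocalRiemannianIsometry_id (n := n) (M := M))
    Function.injective_id x x' hA (by simpa using hA) h (by simpa using h')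

lemma riemannianVolume_eq_chartVolume (x : M) {A : Set M} (hA : MeasurableSet A)
    (h : A ⊆ (chartAt (EuclideanSpace ℝ (Fin n)) x).source) :
    riemannianVolume n M A = chartVolume (n := n) x A := by
  refine le_antisymm ?_ (Measure.le_iff'.1 (le_iSup (fun z : M => chartVolume (n := n) z) x) A)
  set U := (chartAt (EuclideanSpace ℝ (Fin n)) x).source
  have hU : MeasurableSet U := (chartAt (EuclideanSpace ℝ (Fin n)) x).open_source.measurableSet
  -- A supremum of measures is not computed set by set, so it is bounded by one measure: the chart
  -- volume, with the top measure added off the chart domain.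
  have hle : riemannianVolume n M ≤ chartVolume (n := n) x + (⊤ : Measure M).restrict Uᶜ := by
    refine iSup_le fun z => Measure.le_iff.2 fun B hB => ?_
    rw [Measure.add_apply, Measure.restrict_apply hB, ← measure_inter_add_sdiff B hU]
    refine add_le_add ?_ ?_
    · have hBU := hB.inter hU
      rw [← chartVolume_inter_source z hBU]
      refine (chartVolume_eq x z (hBU.inter (chartAt _ z).open_source.measurableSet)
        (fun a ha => ha.1.2) Set.inter_subset_right).le.trans (measure_mono fun a ha => ha.1.1)
    · exact Measure.le_iff'.1 le_top _
  refine (Measure.le_iff'.1 hle A).trans ?_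
  rw [Measure.add_apply, Measure.restrict_apply hA, ← Set.sdiff_eq, Set.sdiff_eq_empty.2 h]
  simp

lemma riemannianVolume_le_image (f : M ≃ₜ M) (hf : IsLocalRiemannianIsometry (n := n) f)
    {A : Set M} (hA : MeasurableSet A) :
    riemannianVolume n M A ≤ riemannianVolume n M (f '' A) := by
  have key : riemannianVolume n M ≤ (riemannianVolume n M).map f.symm := by
    refine iSup_le fun x => Measure.le_iff.2 fun B hB => ?_
    set φ := chartAt (EuclideanSpace ℝ (Fin n)) x
    rw [← chartVolume_inter_source x hB]
    refine le_trans ?_ (measure_mono (Set.inter_subset_left (t := φ.source)))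
    -- The manifold is not assumed second countable; a chart domain is Lindelöf as the image of a
    -- subset of Euclidean space, so countably many charts cover its image under `f`.
    have hlin : IsLindelof φ.source := by
      rw [← φ.symm_image_target_eq_source]
      exact (HereditarilyLindelofSpace.isLindelof φ.target).image_of_continuousOn φ.continuousOn_symm
    let V : M → Set M := fun z => φ.source ∩ f ⁻¹' (chartAt (EuclideanSpace ℝ (Fin n)) (f z)).source
    have hVo : ∀ z, IsOpen (V z) := fun z =>
      φ.open_source.inter ((chartAt _ (f z)).open_source.preimage f.continuous)
    obtain ⟨t, htc, -, htV⟩ := hlin.elim_nhds_subcover V fun z hz =>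
      (hVo z).mem_nhds ⟨hz, mem_chart_source _ (f z)⟩
    rcases t.eq_empty_or_nonempty with rfl | hne
    · have : φ.source = ∅ := by simpa using htV
      rw [this, Set.inter_empty, measure_empty]
      exact zero_le
    obtain ⟨z, rfl⟩ := htc.exists_eq_range hne
    refine measure_le_of_locally_le (V := fun i => V (z i)) (fun i => (hVo _).measurableSet)
      (fun i A hA hAV => ?_) (hB.inter φ.open_source.measurableSet) ?_
    · have him : f '' A ⊆ (chartAt (EuclideanSpace ℝ (Fin n)) (f (z i))).source := by
        rintro _ ⟨a, ha, rfl⟩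
        exact (hAV ha).2
      have hfA : MeasurableSet (f '' A) := f.measurableEmbedding.measurableSet_image.2 hA
      rw [← chartVolume_image hf f.injective x (f (z i)) hA hfA (fun a ha => (hAV ha).1) him,
        Measure.map_apply f.symm.measurable hA, ← riemannianVolume_eq_chartVolume _ hfA him,
        ← f.image_eq_preimage_symm]
    · intro a ha
      simpa using htV ha.2
  have := Measure.le_iff.1 key A hA
  rwa [Measure.map_apply f.symm.measurable hA, ← f.image_eq_preimage_symm] at this

lemma riemannianVolume_image (f : M ≃ₜ M) (hf : IsLocalRiemannianIsometry (n := n) f)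
    (hf' : IsLocalRiemannianIsometry (n := n) f.symm) {A : Set M} (hA : MeasurableSet A) :
    riemannianVolume n M (f '' A) = riemannianVolume n M A := by
  refine le_antisymm ?_ (riemannianVolume_le_image f hf hA)
  have := riemannianVolume_le_image f.symm hf' (f.measurableEmbedding.measurableSet_image.2 hA)
  rwa [← Set.image_comp, f.symm_comp_self, Set.image_id] at this

variable [IsContMDiffRiemannianBundle (𝓡 n) ∞ (EuclideanSpace ℝ (Fin n))
      (fun x : M => TangentSpace (𝓡 n) x)]

lemma riemannianVolume_pos_of_isOpen {U : Set M} (hU : IsOpen U) (hne : U.Nonempty) :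
    0 < riemannianVolume n M U := by
  obtain ⟨x, hx⟩ := hne
  set φ := chartAt (EuclideanSpace ℝ (Fin n)) x
  have hVo : IsOpen (U ∩ φ.source) := hU.inter φ.open_source
  refine lt_of_lt_of_le ?_ (measure_mono (Set.inter_subset_left (t := φ.source)))
  rw [riemannianVolume_eq_chartVolume x hVo.measurableSet Set.inter_subset_right,
    chartVolume_apply x hVo.measurableSet]
  set s := φ.symm ⁻¹' (U ∩ φ.source) ∩ φ.target
  have hso : IsOpen s := by
    have := φ.symm.isOpen_inter_preimage hVo
    rwa [Set.inter_comm] at this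
  have hsx : φ x ∈ s :=
    ⟨by simp [φ, hx], φ.map_source (mem_chart_source _ x)⟩
  have hcont : ContinuousOn (fun y => ENNReal.ofReal √(metricMatrix x y).det) s :=
    ENNReal.continuous_ofReal.comp_continuousOn (Real.continuous_sqrt.comp_continuousOn
      ((continuousOn_metricMatrix_det x).mono Set.inter_subset_right))
  rw [pos_iff_ne_zero, Ne, lintegral_eq_zero_iff' (hcont.aemeasurable hso.measurableSet),
    Filter.EventuallyEq, ae_restrict_iff' hso.measurableSet]
  intro h
  have hs0 : volume s = 0 := by
    refine measure_mono_null (fun y hy => ?_) (ae_iff.1 h)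
    simp only [Set.mem_ofPred_eq, Classical.not_imp]
    refine ⟨hy, ?_⟩
    have := Real.sqrt_pos.2 (metricMatrix_det_pos x hy.2)
    simpa using this
  exact (hso.measure_pos volume ⟨_, hsx⟩).ne' hs0

lemma isLocallyFiniteMeasure_riemannianVolume :
    IsLocallyFiniteMeasure (riemannianVolume n M) := by
  refine ⟨fun x => ?_⟩
  set φ := chartAt (EuclideanSpace ℝ (Fin n)) x
  obtain ⟨K, hKn, hKT, hKc⟩ := local_compact_nhds
    (φ.open_target.mem_nhds (φ.map_source (mem_chart_source _ x)))
  have hcont : ContinuousOn (fun y => √(metricMatrix x y).det) K :=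
    Real.continuous_sqrt.comp_continuousOn ((continuousOn_metricMatrix_det x).mono hKT)
  have hW : φ.source ∩ φ ⁻¹' interior K ∈ 𝓝 x :=
    (φ.isOpen_inter_preimage isOpen_interior).mem_nhds
      ⟨mem_chart_source _ x, mem_interior_iff_mem_nhds.2 hKn⟩
  have hWm : MeasurableSet (φ.source ∩ φ ⁻¹' interior K) :=
    (φ.isOpen_inter_preimage isOpen_interior).measurableSet
  refine ⟨_, hW, ?_⟩
  rw [riemannianVolume_eq_chartVolume x hWm Set.inter_subset_left, chartVolume_apply x hWm]
  refine lt_of_le_of_lt (lintegral_mono_set (t := K) fun y hy => ?_)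
    (hcont.integrableOn_compact hKc).lintegral_lt_top
  have := hy.1.2
  rw [Set.mem_preimage, φ.right_inv hy.2] at this
  exact interior_subset this

end Volume

/-! ### Riemannian distance: local isometries, path lifting, length spaces -/

section LocalIsometry

variable {n : ℕ}
  {M' : Type*} [EMetricSpace M'] [ChartedSpace (EuclideanSpace ℝ (Fin n)) M']
  [RiemannianBundle (fun x : M' => TangentSpace (𝓡 n) x)]
  {M : Type*} [EMetricSpace M] [ChartedSpace (EuclideanSpace ℝ (Fin n)) M]
  [RiemannianBundle (fun x : M => TangentSpace (𝓡 n) x)]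

lemma IsRiemannianCovering.isLocalRiemannianIsometry {p : M' → M}
    (hp : IsRiemannianCovering (n := n) p) : IsLocalRiemannianIsometry (n := n) p :=
  ⟨hp.contMDiff.of_le (by simp), hp.inner_mfderiv⟩

namespace IsLocalRiemannianIsometry

lemma enorm_mfderiv {f : M' → M} (hf : IsLocalRiemannianIsometry (n := n) f) (x : M')
    (v : TangentSpace (𝓡 n) x) : ‖mfderiv (𝓡 n) (𝓡 n) f x v‖ₑ = ‖v‖ₑ := by
  rw [← ofReal_norm, ← ofReal_norm, norm_eq_sqrt_real_inner,
    hf.inner_mfderiv, ← norm_eq_sqrt_real_inner]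

lemma pathELength_comp {f : M' → M} (hf : IsLocalRiemannianIsometry (n := n) f) {c : ℝ → M'}
    (hc : ContMDiffOn 𝓘(ℝ) (𝓡 n) 1 c (Set.Icc 0 1)) :
    pathELength (𝓡 n) (f ∘ c) 0 1 = pathELength (𝓡 n) c 0 1 := by
  rw [pathELength_eq_lintegral_mfderivWithin_Icc, pathELength_eq_lintegral_mfderivWithin_Icc]
  refine setLIntegral_congr_fun measurableSet_Icc fun t ht => ?_
  have hu : UniqueMDiffWithinAt 𝓘(ℝ) (Set.Icc (0 : ℝ) 1) t :=
    (uniqueDiffOn_Icc zero_lt_one t ht).uniqueMDiffWithinAt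
  have := mfderiv_comp_mfderivWithin (I := 𝓘(ℝ)) (I' := 𝓡 n) (I'' := 𝓡 n) (g := f) (f := c) t
    (hf.contMDiff.mdifferentiableAt one_ne_zero)
    ((hc t ht).mdifferentiableWithinAt one_ne_zero) hu
  rw [this]
  exact hf.enorm_mfderiv _ _

lemma edist_le [IsRiemannianManifold (𝓡 n) M] [IsRiemannianManifold (𝓡 n) M'] {f : M' → M}
    (hf : IsLocalRiemannianIsometry (n := n) f) (x y : M') : edist (f x) (f y) ≤ edist x y := by
  refine le_of_forall_gt fun r hr => ?_
  rw [IsRiemannianManifold.out (I := 𝓡 n)] at hr ⊢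
  obtain ⟨c, hc0, hc1, hc, hlen⟩ := exists_lt_of_riemannianEDist_lt hr
  refine (riemannianEDist_le_pathELength (γ := f ∘ c) (a := 0) (b := 1)
    (hf.contMDiff.comp_contMDiffOn hc) (by simp [hc0]) (by simp [hc1]) zero_le_one).trans_lt ?_
  rwa [hf.pathELength_comp hc]

variable [IsManifold (𝓡 n) ∞ M] [IsManifold (𝓡 n) ∞ M']

/-- The density formula of `hasFDerivAt_chart` forces a nonzero Jacobian, since the Gram determinant
is positive, and the inverse function theorem applies in charts. -/
lemma contMDiffOn_symm (e : OpenPartialHomeomorph M' M)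
    (he : IsLocalRiemannianIsometry (n := n) e) :
    ContMDiffOn (𝓡 n) (𝓡 n) 1 e.symm e.target := by
  intro y hy
  refine ContMDiffAt.contMDiffWithinAt ?_
  obtain ⟨x, hx, rfl⟩ : ∃ x ∈ e.source, e x = y := ⟨e.symm y, e.map_target hy, e.right_inv hy⟩
  set φ := chartAt (EuclideanSpace ℝ (Fin n)) x
  set ψ := chartAt (EuclideanSpace ℝ (Fin n)) (e x)
  have hxφ : x ∈ φ.source := mem_chart_source _ x
  have hxψ : e x ∈ ψ.source := mem_chart_source _ (e x)
  set G := φ.symm.trans (e.trans ψ) with hG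
  have hsource : φ x ∈ G.source := by
    simp [hG, φ.left_inv hxφ, hx, hxψ, φ.map_source hxφ]
  have hGx : G (φ x) = ψ (e x) := by simp [hG, φ.left_inv hxφ]
  have htarget : ψ (e x) ∈ G.target := hGx ▸ G.map_source hsource
  have hGs : G.symm (ψ (e x)) = φ x := by rw [← hGx, G.left_inv hsource]
  obtain ⟨L, hL, hdet⟩ := he.hasFDerivAt_chart x (e x) (φ.map_source hxφ)
    (by rw [φ.left_inv hxφ]; exact hxψ)
  have hLdet : L.det ≠ 0 := by
    intro h0
    rw [h0, abs_zero, zero_mul] at hdet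
    exact (Real.sqrt_pos.2 (metricMatrix_det_pos x (φ.map_source hxφ))).ne' hdet
  have hcd : ContDiffAt ℝ 1 G (φ x) := by
    have h1 : ContMDiffAt (𝓡 n) (𝓡 n) 1 φ.symm (φ x) :=
      (contMDiffOn_chart_symm (n := 1) (I := 𝓡 n) (x := x)).contMDiffAt
        (φ.open_target.mem_nhds (φ.map_source hxφ))
    have h2 : ContMDiffAt (𝓡 n) (𝓡 n) 1 e (φ.symm (φ x)) := he.contMDiff.contMDiffAt
    have h3 : ContMDiffAt (𝓡 n) (𝓡 n) 1 ψ (e (φ.symm (φ x))) :=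
      (contMDiffOn_chart (n := 1) (I := 𝓡 n) (x := e x)).contMDiffAt
        (ψ.open_source.mem_nhds (by rw [φ.left_inv hxφ]; exact hxψ))
    have h4 : ContMDiffAt (𝓡 n) (𝓡 n) 1 (ψ ∘ e ∘ φ.symm) (φ x) := h3.comp (φ x) (h2.comp (φ x) h1)
    exact contMDiffAt_iff_contDiffAt.1 h4
  have hinv : ContDiffAt ℝ 1 G.symm (ψ (e x)) := by
    refine G.contDiffAt_symm (f₀' := L.toContinuousLinearEquivOfDetNeZero hLdet) htarget ?_ ?_
    · rw [hGs, ContinuousLinearMap.coe_toContinuousLinearEquivOfDetNeZero]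
      exact hL
    · rwa [hGs]
  rw [contMDiffAt_iff]
  refine ⟨e.continuousAt_symm hy, ?_⟩
  have hex : e.symm (e x) = x := e.left_inv hx
  simp only [mfld_simps]
  rw [hex]
  exact hinv.contDiffWithinAt

/-- Locally `f` is `p ∘ f` followed by a `C¹` local inverse of `p`. This makes lifted paths and deck
transformations differentiable. -/
lemma contMDiffWithinAt_of_comp {p : M' → M} (hp : IsLocalRiemannianIsometry (n := n) p)
    (hloc : IsLocalHomeomorph p)
    {E H : Type*} [NormedAddCommGroup E] [NormedSpace ℝ E] [TopologicalSpace H]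
    {I : ModelWithCorners ℝ E H} {N : Type*} [TopologicalSpace N] [ChartedSpace H N]
    {f : N → M'} {s : Set N} {a : N} (hf : ContinuousWithinAt f s a)
    (hpf : ContMDiffWithinAt I (𝓡 n) 1 (p ∘ f) s a) :
    ContMDiffWithinAt I (𝓡 n) 1 f s a := by
  obtain ⟨e, hxe, rfl⟩ := hloc (f a)
  have h1 := (contMDiffOn_symm e hp).contMDiffAt (e.open_target.mem_nhds (e.map_source hxe))
  refine (h1.comp_contMDiffWithinAt a hpf).congr_of_eventuallyEq ?_ (e.left_inv hxe).symm
  filter_upwards [hf (e.open_source.mem_nhds hxe)] with z hz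
  exact (e.left_inv hz).symm

end IsLocalRiemannianIsometry

namespace IsRiemannianCovering

variable [IsManifold (𝓡 n) ∞ M] [IsManifold (𝓡 n) ∞ M']
  {p : M' → M} (hp : IsRiemannianCovering (n := n) p)
include hp

/-- A continuous self-map of the covering space over the base is a local isometry. -/
lemma isLocalRiemannianIsometry_of_comp_eq {f : M' → M'} (hf : Continuous f) (hpf : p ∘ f = p) :
    IsLocalRiemannianIsometry (n := n) f := by
  have hc : ContMDiff (𝓡 n) (𝓡 n) 1 f := fun x => by
    have := hp.isLocalRiemannianIsometry.contMDiffWithinAt_of_comp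
      hp.isCoveringMap.isLocalHomeomorph (I := 𝓡 n) (s := Set.univ) (a := x)
      hf.continuousWithinAt (by
        rw [hpf]
        exact hp.isLocalRiemannianIsometry.contMDiff.contMDiffAt.contMDiffWithinAt)
    exact this
  refine ⟨hc, fun x v w => ?_⟩
  have h1 : ∀ g : M' → M, g = p →
      inner ℝ (mfderiv (𝓡 n) (𝓡 n) g x v) (mfderiv (𝓡 n) (𝓡 n) g x w) = inner ℝ v w := by
    rintro g rfl
    exact hp.inner_mfderiv x v w
  have h2 := h1 _ hpf
  rw [mfderiv_comp x (hp.isLocalRiemannianIsometry.contMDiff.mdifferentiableAt one_ne_zero)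
    (hc.mdifferentiableAt one_ne_zero)] at h2
  exact (hp.inner_mfderiv (f x) _ _).symm.trans h2

/-- Paths lift to paths of the same length. -/
lemma exists_edist_lt [IsRiemannianManifold (𝓡 n) M] [IsRiemannianManifold (𝓡 n) M']
    (x : M') {m : M} {r : ℝ≥0∞} (h : edist (p x) m < r) :
    ∃ x', p x' = m ∧ edist x x' < r := by
  rw [IsRiemannianManifold.out (I := 𝓡 n)] at h
  obtain ⟨c, hc0, hc1, hc, hlen⟩ := exists_lt_of_riemannianEDist_lt h
  let c₀ : C(unitInterval, M) := ⟨fun t => c t, hc.continuousOn.domRestrict⟩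
  have h0 : c₀ 0 = p x := hc0
  let Γ := hp.isCoveringMap.liftPath c₀ x h0
  let d : ℝ → M' := Set.IccExtend zero_le_one Γ
  have hd : Continuous d := Γ.continuous.Icc_extend'
  have hpd : Set.EqOn (p ∘ d) c (Set.Icc 0 1) := by
    intro t ht
    have := congrFun (hp.isCoveringMap.liftPath_lifts c₀ x h0) ⟨t, ht⟩
    simp only [Function.comp, d, Set.IccExtend_of_mem _ _ ht]
    exact this
  have hdc : ContMDiffOn 𝓘(ℝ) (𝓡 n) 1 d (Set.Icc 0 1) := fun t ht =>
    hp.isLocalRiemannianIsometry.contMDiffWithinAt_of_comp hp.isCoveringMap.isLocalHomeomorph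
      hd.continuousWithinAt ((hc t ht).congr (fun y hy => hpd hy) (hpd ht))
  have hd0 : d 0 = x := by
    have : d 0 = Γ 0 := Set.IccExtend_left _ _
    rw [this]
    exact hp.isCoveringMap.liftPath_zero c₀ x h0
  refine ⟨d 1, ?_, ?_⟩
  · rw [← hc1]
    exact hpd (Set.right_mem_Icc.2 zero_le_one)
  · rw [IsRiemannianManifold.out (I := 𝓡 n)]
    refine (riemannianEDist_le_pathELength (γ := d) (a := 0) (b := 1) hdc hd0 rfl
      zero_le_one).trans_lt ?_
    rwa [← hp.isLocalRiemannianIsometry.pathELength_comp hdc, pathELength_congr hpd]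

end IsRiemannianCovering

/-- A Riemannian manifold is a length space. -/
lemma exists_edist_lt_of_edist_lt_add [IsRiemannianManifold (𝓡 n) M] {x y : M} {a b : ℝ≥0∞}
    (ha : 0 < a) (hb : 0 < b) (h : edist x y < a + b) :
    ∃ z, edist x z < a ∧ edist z y < b := by
  rcases lt_or_ge (edist x y) a with hxa | hxa
  · exact ⟨y, hxa, by simpa using hb⟩
  have hab : a ≠ ⊤ := fun h' => by simp [h'] at hxa; simp [hxa] at h
  have h' := h
  rw [IsRiemannianManifold.out (I := 𝓡 n)] at h'
  obtain ⟨c, hc0, hc1, hc, hlen⟩ := exists_lt_of_riemannianEDist_lt h'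
  set ℓ := pathELength (𝓡 n) c 0 1
  -- The slack in `ℓ < a + b` leaves room for `a' < a`; the path is cut where its distance from `x`
  -- equals `a'`.
  obtain ⟨a', ha', ha'a, hlen'⟩ : ∃ a', ℓ < a' + b ∧ a' < a ∧ a' ≠ ⊤ := by
    have : Tendsto (fun u : ℝ≥0∞ => u + b) (𝓝[<] a) (𝓝 (a + b)) :=
      ((continuous_id.add continuous_const).tendsto a).mono_left nhdsWithin_le_nhds
    have hne : (𝓝[<] a).NeBot := nhdsLT_neBot_of_exists_lt ⟨0, ha⟩
    obtain ⟨u, hu1, hu2⟩ := ((this.eventually (lt_mem_nhds hlen)).and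
      self_mem_nhdsWithin).exists
    exact ⟨u, hu1, hu2, ne_top_of_lt hu2⟩
  have hcont : ContinuousOn (fun t => edist x (c t)) (Set.Icc 0 1) :=
    (continuous_const.edist continuous_id).comp_continuousOn hc.continuousOn
  obtain ⟨t, ht, hta⟩ : a' ∈ (fun t => edist x (c t)) '' Set.Icc 0 1 := by
    refine intermediate_value_Icc zero_le_one hcont ⟨?_, ?_⟩
    · simp [hc0]
    · simpa [hc1] using ha'a.le.trans hxa
  refine ⟨c t, by simpa [hta] using ha'a, ?_⟩
  have h1 : a' ≤ pathELength (𝓡 n) c 0 t := by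
    rw [← hta]
    simp only
    rw [IsRiemannianManifold.out (I := 𝓡 n)]
    exact riemannianEDist_le_pathELength (hc.mono (Set.Icc_subset_Icc_right ht.2)) hc0 rfl ht.1
  have h2 : edist (c t) y ≤ pathELength (𝓡 n) c t 1 := by
    rw [IsRiemannianManifold.out (I := 𝓡 n)]
    exact riemannianEDist_le_pathELength (hc.mono (Set.Icc_subset_Icc_left ht.1)) rfl hc1 ht.2
  have h3 : a' + pathELength (𝓡 n) c t 1 < a' + b :=
    (add_le_add_left h1 _).trans_lt (by rwa [pathELength_add ht.1 ht.2])
  exact h2.trans_lt ((ENNReal.add_lt_add_iff_left hlen').1 h3)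

/-- The points at finite distance from `x` form a nonempty clopen set. -/
lemma edist_ne_top_of_connectedSpace [ConnectedSpace M] (x y : M) : edist x y ≠ ⊤ := by
  have : IsClopen (Metric.eball x ⊤) := ⟨Metric.isClosed_eball_top, Metric.isOpen_eball⟩
  have h := this.eq_univ ⟨x, by simp⟩
  have hy : y ∈ Metric.eball x ⊤ := h ▸ Set.mem_univ y
  rw [edist_comm]
  exact (Metric.mem_eball.1 hy).ne

end LocalIsometry

/-! ### Deck transformations and the fundamental group -/

section DeckGroup

variable {E X : Type*} [TopologicalSpace E]

/-- The group of deck transformations of a map. -/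
def deckGroup (p : E → X) : Subgroup (E ≃ₜ E) where
  carrier := {f | p ∘ f = p}
  mul_mem' {f g} hf hg := by
    ext x
    exact (congrFun hf (g x)).trans (congrFun hg x)
  one_mem' := rfl
  inv_mem' {f} hf := by
    ext x
    have := congrFun hf (f.symm x)
    simpa using this.symm

instance (p : E → X) : MulAction (deckGroup p) E where
  smul f x := f.1 x
  one_smul _ := rfl
  mul_smul _ _ _ := rfl

variable {p : E → X}

lemma deckGroup_apply (f : deckGroup p) (x : E) : p (f • x) = p x := congrFun f.2 x

variable [TopologicalSpace X]

lemma deckGroup_eq_one [PreconnectedSpace E] (cov : IsCoveringMap p) {f : deckGroup p} {x : E}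
    (h : f • x = x) : f = 1 := by
  refine Subtype.ext (Homeomorph.ext (congrFun ?_))
  exact cov.eq_of_comp_eq f.1.continuous continuous_id f.2 x h

/-- The map `p` lifts through itself with `x ↦ y` and with `y ↦ x`; both composites are lifts of `p`
with a fixed point, hence the identity. -/
lemma exists_deckGroup_smul_eq [SimplyConnectedSpace E] [LocallyPathConnectedSpace E]
    (cov : IsCoveringMap p) {x y : E} (h : p x = p y) : ∃ f : deckGroup p, f • x = y := by
  obtain ⟨F, ⟨hFx, hF⟩, -⟩ := cov.existsUnique_continuousMap_lifts ⟨p, cov.continuous⟩ x y h.symm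
  obtain ⟨F', ⟨hFy, hF'⟩, -⟩ := cov.existsUnique_continuousMap_lifts ⟨p, cov.continuous⟩ y x h
  replace hF : p ∘ F = p := hF
  replace hF' : p ∘ F' = p := hF'
  have h1 : F' ∘ F = id := cov.eq_of_comp_eq (F'.continuous.comp F.continuous) continuous_id
    (by rw [← Function.comp_assoc, hF', hF]; rfl) x (by simp [hFx, hFy])
  have h2 : F ∘ F' = id := cov.eq_of_comp_eq (F.continuous.comp F'.continuous) continuous_id
    (by rw [← Function.comp_assoc, hF, hF']; rfl) y (by simp [hFx, hFy])
  exact ⟨⟨⟨⟨F, F', congrFun h1, congrFun h2⟩, F.continuous, F'.continuous⟩, hF⟩, hFx⟩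

/-- A simply connected covering is the quotient map for its group of deck transformations. -/
lemma isQuotientCoveringMap_deckGroup [SimplyConnectedSpace E] [LocallyPathConnectedSpace E]
    (cov : IsCoveringMap p) (hsurj : Function.Surjective p) :
    IsQuotientCoveringMap p (deckGroup p) where
  __ := cov.isQuotientMap hsurj
  continuous_const_smul f := f.1.continuous
  apply_eq_iff_mem_orbit {x y} :=
    ⟨fun h => exists_deckGroup_smul_eq cov h.symm, by rintro ⟨f, rfl⟩; exact deckGroup_apply f y⟩
  disjoint x := by
    obtain ⟨e, hxe, rfl⟩ := cov.isLocalHomeomorph x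
    refine ⟨e.source, e.open_source.mem_nhds hxe, ?_⟩
    rintro f ⟨_, ⟨y, hy, rfl⟩, hfy⟩
    exact deckGroup_eq_one cov (e.injOn hfy hy (deckGroup_apply f y))

/-- The fundamental group of the base of a simply connected quotient covering. -/
def IsQuotientCoveringMap.fundamentalGroupMulEquiv {G : Type*} [Group G] [MulAction G E]
    [SimplyConnectedSpace E] (hp : IsQuotientCoveringMap p G) (m : X) :
    FundamentalGroup X m ≃* G :=
  -- The monodromy isomorphism lands in the opposite group; inversion restores the order of
  -- multiplication.
  (hp.fundamentalGroupEquiv ⟨_, (hp.surjective m).choose_spec⟩).trans (MulEquiv.inv' G).symm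

end DeckGroup

/-! ### The deck action: isometric, cocompact, on a space with compact balls -/

namespace IsRiemannianCovering

variable {n : ℕ}
  {M : Type*} [EMetricSpace M] [ChartedSpace (EuclideanSpace ℝ (Fin n)) M]
  [IsManifold (𝓡 n) ∞ M] [RiemannianBundle (fun x : M => TangentSpace (𝓡 n) x)]
  [IsRiemannianManifold (𝓡 n) M]
  {M' : Type*} [EMetricSpace M'] [ChartedSpace (EuclideanSpace ℝ (Fin n)) M']
  [IsManifold (𝓡 n) ∞ M'] [RiemannianBundle (fun x : M' => TangentSpace (𝓡 n) x)]
  [IsRiemannianManifold (𝓡 n) M']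
  {p : M' → M} (hp : IsRiemannianCovering (n := n) p)
include hp

omit [IsRiemannianManifold (𝓡 n) M] in
lemma edist_smul (g : deckGroup p) (x y : M') : edist (g • x) (g • y) = edist x y := by
  refine le_antisymm
    ((hp.isLocalRiemannianIsometry_of_comp_eq g.1.continuous g.2).edist_le x y) ?_
  have := (hp.isLocalRiemannianIsometry_of_comp_eq (g⁻¹).1.continuous (g⁻¹).2).edist_le
    (g • x) (g • y)
  change edist (g⁻¹ • g • x) (g⁻¹ • g • y) ≤ _ at this
  rwa [inv_smul_smul, inv_smul_smul] at this

lemma surjective [ConnectedSpace M] [Nonempty M'] : Function.Surjective p := fun m => by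
  obtain ⟨x⟩ := ‹Nonempty M'›
  obtain ⟨y, hy, -⟩ := hp.exists_edist_lt x
    (lt_top_iff_ne_top.2 (edist_ne_top_of_connectedSpace (p x) m))
  exact ⟨y, hy⟩

variable [SimplyConnectedSpace M']

omit [IsRiemannianManifold (𝓡 n) M] [IsRiemannianManifold (𝓡 n) M'] [IsManifold (𝓡 n) ∞ M]
  [IsManifold (𝓡 n) ∞ M'] in
lemma exists_smul_eq {x y : M'} (h : p x = p y) : ∃ g : deckGroup p, g • x = y := by
  have : LocallyPathConnectedSpace M' :=
    ChartedSpace.locallyPathConnectedSpace (EuclideanSpace ℝ (Fin n)) M'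
  exact exists_deckGroup_smul_eq hp.isCoveringMap h

lemma isQuotientCoveringMap [ConnectedSpace M] : IsQuotientCoveringMap p (deckGroup p) := by
  have : LocallyPathConnectedSpace M' :=
    ChartedSpace.locallyPathConnectedSpace (EuclideanSpace ℝ (Fin n)) M'
  exact isQuotientCoveringMap_deckGroup hp.isCoveringMap hp.surjective

variable [CompactSpace M]

/-- Closed balls of some uniform positive radius are compact. -/
lemma exists_isCompact_closedEBall [ConnectedSpace M] :
    ∃ ε : ℝ≥0, 0 < ε ∧ ∀ x : M', IsCompact (Metric.closedEBall x ε) := by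
  have : LocallyCompactSpace M' :=
    ChartedSpace.locallyCompactSpace (EuclideanSpace ℝ (Fin n)) M'
  have hloc : ∀ m : M, ∃ y : M', p y = m ∧ ∃ ε : ℝ≥0, 0 < ε ∧
      IsCompact (Metric.closedEBall y (2 * ε)) := by
    intro m
    obtain ⟨y, hy⟩ := hp.surjective m
    obtain ⟨K, hK, -, hKc⟩ := local_compact_nhds (univ_mem (f := 𝓝 y))
    obtain ⟨ε, hε, hεK⟩ := Metric.nhds_basis_closedEBall.mem_iff.1 hK
    obtain ⟨δ, hδ, hδε⟩ := ENNReal.lt_iff_exists_nnreal_btwn.1 hε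
    have hδ' : (0 : ℝ≥0) < δ := by exact_mod_cast hδ
    refine ⟨y, hy, δ / 2, half_pos hδ', hKc.of_isClosed_subset Metric.isClosed_closedEBall
      ((Metric.closedEBall_subset_closedEBall ?_).trans hεK)⟩
    have : (2 : ℝ≥0∞) * ((δ / 2 : ℝ≥0) : ℝ≥0∞) = δ := by
      rw [← ENNReal.coe_ofNat, ← ENNReal.coe_mul, mul_div_cancel₀ _ two_ne_zero]
    rw [this]
    exact hδε.le
  choose y hy ε hε hc using hloc
  obtain ⟨t, -, ht⟩ := isCompact_univ.elim_nhds_subcover (fun m : M => Metric.eball m (ε m))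
    fun m _ => Metric.eball_mem_nhds m (by exact_mod_cast hε m)
  have htne : t.Nonempty := by
    obtain ⟨m⟩ := (inferInstance : Nonempty M)
    obtain ⟨i, hi⟩ := Set.mem_iUnion.1 (ht (Set.mem_univ m))
    obtain ⟨hi, -⟩ := Set.mem_iUnion.1 hi
    exact ⟨i, hi⟩
  refine ⟨t.inf' htne ε, (Finset.lt_inf'_iff htne).2 fun m _ => hε m, fun x => ?_⟩
  obtain ⟨m, hm⟩ := Set.mem_iUnion.1 (ht (Set.mem_univ (p x)))
  obtain ⟨hmt, hm⟩ := Set.mem_iUnion.1 hm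
  -- Lifting a short path puts `x` within `ε m` of a translate of `y m`, so the ball around `x` lies
  -- in the translate of the compact ball of radius `2 * ε m`.
  obtain ⟨z, hz, hxz⟩ := hp.exists_edist_lt x (Metric.mem_eball.1 hm)
  obtain ⟨g, rfl⟩ := hp.exists_smul_eq ((hy m).trans hz.symm)
  refine ((hc m).image (g.1.continuous)).of_isClosed_subset Metric.isClosed_closedEBall ?_
  intro w hw
  refine ⟨g⁻¹ • w, ?_, smul_inv_smul g w⟩
  rw [Metric.mem_closedEBall, ← hp.edist_smul g, smul_inv_smul, two_mul]
  refine (edist_triangle w x _).trans (add_le_add ((Metric.mem_closedEBall.1 hw).trans ?_) hxz.le)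
  exact_mod_cast Finset.inf'_le _ hmt

/-- A Hopf–Rinow type induction, enlarging the radius by `δ = ε / 4`. A point of the larger ball is
within `2 * δ` of the smaller one by the length-space property, and the smaller one is covered by
finitely many `δ`-balls; as `2 * δ + δ ≤ ε`, finitely many compact `ε`-balls cover the larger ball.
-/
lemma isCompact_closedEBall [ConnectedSpace M] (x : M') (r : ℝ≥0) :
    IsCompact (Metric.closedEBall x r) := by
  obtain ⟨ε, hε, hc⟩ := hp.exists_isCompact_closedEBall
  set δ : ℝ≥0 := ε / 4
  have hδ : 0 < δ := by positivity
  have hδε : 4 * δ = ε := mul_div_cancel₀ _ four_ne_zero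
  have key : ∀ k : ℕ, IsCompact (Metric.closedEBall x (((k + 1 : ℕ) * δ : ℝ≥0) : ℝ≥0∞)) := by
    intro k
    induction k with
    | zero =>
      refine (hc x).of_isClosed_subset Metric.isClosed_closedEBall
        (Metric.closedEBall_subset_closedEBall ?_)
      rw [← hδε]
      norm_cast
      gcongr
      norm_num
    | succ k ih =>
      set r : ℝ≥0 := (k + 1 : ℕ) * δ
      have hr : 0 < r := by positivity
      obtain ⟨t, -, ht⟩ := ih.elim_nhds_subcover (fun y => Metric.eball y δ)
        fun y _ => Metric.eball_mem_nhds y (by exact_mod_cast hδ)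
      refine (t.isCompact_biUnion fun y _ => hc y).of_isClosed_subset
        Metric.isClosed_closedEBall fun z hz => ?_
      have hz' : edist x z < (r : ℝ≥0∞) + (2 * δ : ℝ≥0) := by
        rw [edist_comm]
        refine (Metric.mem_closedEBall.1 hz).trans_lt ?_
        have : ((k + 1 + 1 : ℕ) : ℝ≥0) * δ < r + 2 * δ := by
          rw [Nat.cast_succ, add_mul, one_mul, two_mul]
          exact (add_lt_add_iff_left r).2 (lt_add_of_pos_left δ hδ)
        exact_mod_cast this
      obtain ⟨w, hxw, hwz⟩ := exists_edist_lt_of_edist_lt_add (n := n)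
        (by exact_mod_cast hr) (by exact_mod_cast mul_pos two_pos hδ) hz'
      have hw : w ∈ Metric.closedEBall x r := by
        rw [Metric.mem_closedEBall, edist_comm]
        exact hxw.le
      obtain ⟨y, hyw⟩ := Set.mem_iUnion.1 (ht hw)
      obtain ⟨hy, hyw⟩ := Set.mem_iUnion.1 hyw
      refine Set.mem_iUnion₂.2 ⟨y, hy, ?_⟩
      rw [Metric.mem_closedEBall]
      refine (edist_triangle z w y).trans ?_
      rw [edist_comm z w]
      refine (add_le_add hwz.le (Metric.mem_eball.1 hyw).le).trans ?_
      rw [← hδε]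
      norm_cast
      rw [show 2 * δ + δ = 3 * δ by ring]
      gcongr
      norm_num
  refine (key ⌈r / δ⌉₊).of_isClosed_subset Metric.isClosed_closedEBall
    (Metric.closedEBall_subset_closedEBall ?_)
  have : r ≤ ((⌈r / δ⌉₊ + 1 : ℕ) : ℝ≥0) * δ := by
    rw [← div_le_iff₀ hδ]
    exact (Nat.le_ceil _).trans (by exact_mod_cast Nat.le_succ _)
  exact_mod_cast this

/-- Orbits of the deck group are coarsely dense. -/
lemma exists_forall_edist_smul_lt [ConnectedSpace M] (x₀ : M') :
    ∃ D : ℝ≥0, ∀ x : M', ∃ g : deckGroup p, edist x (g • x₀) < D := by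
  obtain ⟨m, -, hm⟩ := isCompact_univ.exists_isMaxOn (Set.univ_nonempty (α := M))
    (continuous_id.edist (continuous_const (y := p x₀))).continuousOn
  obtain ⟨D, hD, -⟩ := ENNReal.lt_iff_exists_nnreal_btwn.1
    (lt_top_iff_ne_top.2 (edist_ne_top_of_connectedSpace m (p x₀)))
  refine ⟨D, fun x => ?_⟩
  obtain ⟨y, hy, hxy⟩ := hp.exists_edist_lt x ((hm (Set.mem_univ (p x))).trans_lt hD)
  obtain ⟨g, rfl⟩ := hp.exists_smul_eq hy.symm
  exact ⟨g, hxy⟩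

end IsRiemannianCovering

/-! ### Displacement length, and its comparison with volume -/

/-- The displacement of the point `x₀` under a deck transformation. -/
def deckLength {M' X : Type*} [EMetricSpace M'] (p : M' → X) (x₀ : M') (g : deckGroup p) : ℝ≥0 :=
  (edist x₀ (g • x₀)).toNNReal

lemma monotone_volumeGrowth {n : ℕ} {M : Type*} [EMetricSpace M]
    [ChartedSpace (EuclideanSpace ℝ (Fin n)) M]
    [RiemannianBundle (fun x : M => TangentSpace (𝓡 n) x)] [MeasurableSpace M] (x : M) :
    Monotone (volumeGrowth n x) := fun _ _ h =>
  measure_mono fun _ hy => le_trans (Set.mem_ofPred_eq ▸ hy) (by exact_mod_cast h)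

lemma coe_deckLength {M' X : Type*} [EMetricSpace M']
    [SimplyConnectedSpace M'] {p : M' → X} (x₀ : M') (g : deckGroup p) :
    (deckLength p x₀ g : ℝ≥0∞) = edist x₀ (g • x₀) :=
  ENNReal.coe_toNNReal (edist_ne_top_of_connectedSpace _ _)

namespace IsRiemannianCovering

variable {n : ℕ}
  {M : Type*} [EMetricSpace M] [ChartedSpace (EuclideanSpace ℝ (Fin n)) M]
  [IsManifold (𝓡 n) ∞ M] [RiemannianBundle (fun x : M => TangentSpace (𝓡 n) x)]
  [IsRiemannianManifold (𝓡 n) M] [CompactSpace M] [ConnectedSpace M]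
  {M' : Type*} [EMetricSpace M'] [ChartedSpace (EuclideanSpace ℝ (Fin n)) M']
  [IsManifold (𝓡 n) ∞ M'] [RiemannianBundle (fun x : M' => TangentSpace (𝓡 n) x)]
  [IsRiemannianManifold (𝓡 n) M'] [SimplyConnectedSpace M']
  {p : M' → M}

variable (hp : IsRiemannianCovering (n := n) p)
include hp

/-- The fibre through `x₀` is closed and discrete, so it meets a compact ball in a finite set; the
action is free, so orbit points determine `g`. -/
lemma finite_deckLength_le (x₀ : M') (r : ℝ≥0) : {g | deckLength p x₀ g ≤ r}.Finite := by
  have hK := hp.isCompact_closedEBall x₀ r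
  have hcl : IsClosed (p ⁻¹' {p x₀}) := isClosed_singleton.preimage hp.isCoveringMap.continuous
  have hdisc : IsDiscrete (p ⁻¹' {p x₀}) := ⟨(hp.isCoveringMap (p x₀)).discreteTopology_fiber⟩
  have hfin := (hK.inter_right hcl).finite (hdisc.mono Set.inter_subset_right)
  refine (hfin.preimage (f := fun g : deckGroup p => g • x₀) fun g _ h _ hgh => ?_).subset
    fun g hg => ⟨?_, deckGroup_apply g x₀⟩
  · have : (h⁻¹ * g) • x₀ = x₀ := by
      rw [mul_smul, inv_smul_eq_iff]
      exact hgh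
    have := deckGroup_eq_one hp.isCoveringMap this
    rwa [inv_mul_eq_one, eq_comm] at this
  · rw [Metric.mem_closedEBall, edist_comm, ← coe_deckLength]
    exact_mod_cast hg

lemma isGeometricLength_deckLength (x₀ : M') : IsGeometricLength (deckLength p x₀) where
  map_one := by simp [deckLength]
  map_mul_le g h := by
    rw [← ENNReal.coe_le_coe, ENNReal.coe_add]
    simp only [coe_deckLength]
    refine (edist_triangle _ (g • x₀) _).trans (add_le_add le_rfl ?_)
    rw [mul_smul, hp.edist_smul]
  map_inv g := by
    rw [deckLength, deckLength, ← hp.edist_smul g, smul_inv_smul, edist_comm]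
  finite_le := hp.finite_deckLength_le x₀
  exists_word := by
    obtain ⟨D, hD⟩ := hp.exists_forall_edist_smul_lt x₀
    refine ⟨D + 1 + D, ?_⟩
    -- The endpoint is relaxed to any `x` within `D` of `g • x₀`, so that the induction can stop at
    -- cut points off the orbit. The strict bound needed for cutting accounts for `k + 1`.
    -- Neighbouring orbit points are at most `D + 1 + D` apart.
    suffices h : ∀ (k : ℕ) (x : M') (g : deckGroup p), edist x₀ x < (k + 1 : ℕ) →
        edist x (g • x₀) ≤ D → ∃ w : List (deckGroup p), w.length ≤ k + 1 ∧
          (∀ s ∈ w, deckLength p x₀ s ≤ D + 1 + D) ∧ w.prod = g by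
      intro k g hg
      refine h k (g • x₀) g ?_ (by simp)
      rw [← coe_deckLength]
      have : deckLength p x₀ g < (k + 1 : ℕ) := hg.trans_lt (by exact_mod_cast Nat.lt_succ_self k)
      exact_mod_cast this
    intro k
    induction k with
    | zero =>
      intro x g hx hg
      refine ⟨[g], le_rfl, ?_, by simp⟩
      intro s hs
      rw [List.mem_singleton.1 hs, ← ENNReal.coe_le_coe, coe_deckLength]
      refine (edist_triangle _ x _).trans ((add_le_add hx.le hg).trans ?_)
      push_cast
      gcongr
      exact le_add_self
    | succ k ih =>
      intro x g hx hg
      rw [Nat.cast_succ] at hx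
      obtain ⟨z, hxz, hzx⟩ := exists_edist_lt_of_edist_lt_add (n := n)
        (by exact_mod_cast Nat.succ_pos k) one_pos hx
      obtain ⟨h, hh⟩ := hD z
      obtain ⟨w, hw, hwD, hwh⟩ := ih z h hxz hh.le
      refine ⟨w ++ [h⁻¹ * g], by simpa using hw, ?_, by simp [hwh]⟩
      intro s hs
      rcases List.mem_append.1 hs with hs | hs
      · exact hwD s hs
      rw [List.mem_singleton.1 hs, ← ENNReal.coe_le_coe, coe_deckLength, ← hp.edist_smul h,
        mul_smul, smul_inv_smul]
      push_cast
      refine (edist_triangle _ x _).trans (add_le_add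
        ((edist_triangle _ z _).trans (add_le_add ?_ hzx.le)) hg)
      rw [edist_comm]
      exact hh.le

variable [MeasurableSpace M'] [BorelSpace M']

omit [IsRiemannianManifold (𝓡 n) M] [CompactSpace M] [ConnectedSpace M]
  [IsRiemannianManifold (𝓡 n) M'] [SimplyConnectedSpace M'] in
lemma riemannianVolume_image_smul (g : deckGroup p) {A : Set M'} (hA : MeasurableSet A) :
    riemannianVolume n M' ((fun x => g • x) '' A) = riemannianVolume n M' A :=
  riemannianVolume_image g.1 (hp.isLocalRiemannianIsometry_of_comp_eq g.1.continuous g.2)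
    (hp.isLocalRiemannianIsometry_of_comp_eq (g⁻¹).1.continuous (g⁻¹).2) hA

variable [IsContMDiffRiemannianBundle (𝓡 n) ∞ (EuclideanSpace ℝ (Fin n))
      (fun x : M' => TangentSpace (𝓡 n) x)]

lemma riemannianVolume_closedEBall_lt_top (x : M') (r : ℝ≥0) :
    riemannianVolume n M' (Metric.closedEBall x r) < ⊤ :=
  have := isLocallyFiniteMeasure_riemannianVolume (n := n) (M := M')
  (hp.isCompact_closedEBall x r).measure_lt_top

/-- Covering: the ball of radius `r` lies in the union of the translates of the `D`-ball by elements
of displacement at most `r + D`, all of the same volume. -/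
lemma volumeGrowth_dominated (x₀ : M') :
    GrowthDominated (volumeGrowth n x₀) (lengthGrowth (deckLength p x₀)) := by
  obtain ⟨D, hD⟩ := hp.exists_forall_edist_smul_lt x₀
  set V := (riemannianVolume n M' (Metric.closedEBall x₀ D)).toNNReal
  have hV : (V : ℝ≥0∞) = riemannianVolume n M' (Metric.closedEBall x₀ D) :=
    ENNReal.coe_toNNReal (hp.riemannianVolume_closedEBall_lt_top x₀ D).ne
  refine .of_le (hp.isGeometricLength_deckLength x₀).monotone_lengthGrowth V 1 D 0 fun r => ?_
  have hfin := hp.finite_deckLength_le x₀ (1 * r + D)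
  have hsub : {y | edist y x₀ ≤ r} ⊆ ⋃ g ∈ hfin.toFinset,
      (fun x => g • x) '' Metric.closedEBall x₀ D := by
    intro y hy
    obtain ⟨g, hg⟩ := hD y
    refine Set.mem_iUnion₂.2 ⟨g, ?_, g⁻¹ • y, ?_, smul_inv_smul g y⟩
    · rw [Set.Finite.mem_toFinset, Set.mem_ofPred_eq, ← ENNReal.coe_le_coe, coe_deckLength]
      push_cast
      rw [one_mul]
      refine (edist_triangle _ y _).trans (add_le_add ?_ hg.le)
      rw [edist_comm]
      exact hy
    · rw [Metric.mem_closedEBall, ← hp.edist_smul g, smul_inv_smul]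
      exact hg.le
  calc volumeGrowth n x₀ r ≤ ∑ g ∈ hfin.toFinset,
        riemannianVolume n M' ((fun x => g • x) '' Metric.closedEBall x₀ D) :=
      (measure_mono hsub).trans (measure_biUnion_finset_le _ _)
    _ = V * lengthGrowth (deckLength p x₀) (1 * r + D) + (0 : ℝ≥0) := by
      rw [Finset.sum_congr rfl fun g _ =>
        hp.riemannianVolume_image_smul g Metric.isClosed_closedEBall.measurableSet,
        Finset.sum_const, ← hV, nsmul_eq_mul, lengthGrowth, Set.ncard_eq_toFinset_card _ hfin]
      simp [mul_comm]

/-- Packing: the disjoint translates of `W` by elements of displacement at most `r` fit in the ball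
of radius `r + 1`, since `W` lies in a unit ball around `x₀`. -/
lemma dominated_volumeGrowth (x₀ : M') :
    GrowthDominated (lengthGrowth (deckLength p x₀)) (volumeGrowth n x₀) := by
  obtain ⟨U, hU, hdisj⟩ := hp.isQuotientCoveringMap.disjoint x₀
  set W := interior U ∩ Metric.eball x₀ 1
  have hWo : IsOpen W := isOpen_interior.inter Metric.isOpen_eball
  have hWpos : 0 < riemannianVolume n M' W :=
    riemannianVolume_pos_of_isOpen hWo ⟨x₀, mem_interior_iff_mem_nhds.2 hU, by simp⟩
  have hWtop : riemannianVolume n M' W ≠ ⊤ := by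
    refine (lt_of_le_of_lt (measure_mono (Set.inter_subset_right.trans ?_))
      (hp.riemannianVolume_closedEBall_lt_top x₀ 1)).ne
    exact Metric.eball_subset_closedEBall
  set w := (riemannianVolume n M' W).toNNReal
  have hw : (w : ℝ≥0∞) = riemannianVolume n M' W := ENNReal.coe_toNNReal hWtop
  have hw0 : w ≠ 0 := by
    intro h
    rw [h, ENNReal.coe_zero] at hw
    exact hWpos.ne hw
  refine .of_le (monotone_volumeGrowth x₀) w⁻¹ 1 1 0 fun r => ?_
  have hfin := hp.finite_deckLength_le x₀ r
  have hpd : (hfin.toFinset : Set (deckGroup p)).PairwiseDisjoint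
      fun g => (fun x => g • x) '' W := by
    intro g _ h _ hgh
    rw [Function.onFun, Set.disjoint_left]
    rintro _ ⟨a, ha, rfl⟩ ⟨b, hb, hab⟩
    refine hgh ?_
    have := hdisj (h⁻¹ * g) ⟨b, ⟨a, interior_subset ha.1, ?_⟩, interior_subset hb.1⟩
    · rwa [inv_mul_eq_one, eq_comm] at this
    · simp only [mul_smul]
      rw [inv_smul_eq_iff]
      exact hab.symm
  have hsub : ⋃ g ∈ hfin.toFinset, (fun x => g • x) '' W ⊆
      {y | edist y x₀ ≤ (1 * r + 1 : ℝ≥0)} := by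
    refine Set.iUnion₂_subset fun g hg => ?_
    rintro _ ⟨a, ha, rfl⟩
    rw [Set.Finite.mem_toFinset, Set.mem_ofPred_eq, ← ENNReal.coe_le_coe, coe_deckLength,
      edist_comm] at hg
    rw [Set.mem_ofPred_eq, one_mul, add_comm]
    push_cast
    refine (edist_triangle _ (g • x₀) _).trans (add_le_add ?_ hg)
    rw [hp.edist_smul]
    exact (Metric.mem_eball.1 ha.2).le
  have hle : lengthGrowth (deckLength p x₀) r * w ≤ volumeGrowth n x₀ (1 * r + 1) := by
    refine le_trans (le_of_eq ?_) (measure_mono hsub)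
    rw [measure_biUnion_finset hpd fun g _ =>
      (g.1.measurableEmbedding.measurableSet_image.2 hWo.measurableSet),
      Finset.sum_congr rfl fun g _ => hp.riemannianVolume_image_smul g hWo.measurableSet,
      Finset.sum_const, ← hw, nsmul_eq_mul, lengthGrowth, Set.ncard_eq_toFinset_card _ hfin]
  rw [ENNReal.coe_zero, add_zero, ENNReal.coe_inv hw0, mul_comm, ← div_eq_mul_inv,
    ENNReal.le_div_iff_mul_le (Or.inl (by simpa using hw0)) (Or.inl ENNReal.coe_ne_top)]
  exact hle

end IsRiemannianCovering

/-! ### The fundamental group of the torus -/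

section Torus

variable (l : ℕ)

/-- The projection from `ℝˡ` to the torus. -/
def torusProjection : (Fin l → ℝ) →+ (Fin l → UnitAddCircle) where
  toFun x i := (x i : UnitAddCircle)
  map_zero' := by ext i; simp
  map_add' x y := by ext i; simp

lemma mem_ker_torusProjection {x : Fin l → ℝ} :
    x ∈ (torusProjection l).ker ↔ ∃ z : Fin l → ℤ, (fun i => (z i : ℝ)) = x := by
  rw [AddMonoidHom.mem_ker, funext_iff]
  simp only [torusProjection, AddMonoidHom.coe_mk, ZeroHom.coe_mk, Pi.zero_apply]
  constructor
  · intro h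
    have : ∀ i, ∃ z : ℤ, (z : ℝ) = x i := fun i => by
      obtain ⟨z, hz⟩ := (AddCircle.coe_eq_zero_iff (1 : ℝ)).1 (h i)
      exact ⟨z, by simpa using hz⟩
    choose z hz using this
    exact ⟨z, funext hz⟩
  · rintro ⟨z, rfl⟩ i
    exact (AddCircle.coe_eq_zero_iff (1 : ℝ)).2 ⟨z i, by simp⟩

/-- The kernel of the projection from `ℝˡ` to the torus is `ℤˡ`. -/
def latticeEquivKer : (Fin l → ℤ) ≃+ (torusProjection l).ker :=
  AddEquiv.ofBijective
    (AddMonoidHom.mk' (fun z => ⟨fun i => (z i : ℝ), (mem_ker_torusProjection l).2 ⟨z, rfl⟩⟩)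
      fun a b => by ext i; simp)
    ⟨fun a b hab => by
      ext i
      have := congrFun (congrArg Subtype.val hab) i
      simpa using this,
    fun ⟨x, hx⟩ => by
      obtain ⟨z, rfl⟩ := (mem_ker_torusProjection l).1 hx
      exact ⟨z, rfl⟩⟩

lemma isDiscrete_ker_torusProjection : IsDiscrete ((torusProjection l).ker : Set (Fin l → ℝ)) := by
  have h : ((torusProjection l).ker : Set (Fin l → ℝ)) =
      Set.range fun z : Fin l → ℤ => fun i => (z i : ℝ) :=
    Set.ext fun x => mem_ker_torusProjection l
  rw [h]
  have hind : IsEmbedding fun z : Fin l → ℤ => fun i => (z i : ℝ) :=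
    IsEmbedding.piMap fun _ => Int.isClosedEmbedding_coe_real.isEmbedding
  exact ⟨hind.toHomeomorph.discreteTopology⟩

lemma isQuotientMap_torusProjection : IsQuotientMap (torusProjection l) :=
  (IsOpenQuotientMap.piMap (f := fun (_ : Fin l) (x : ℝ) => (x : UnitAddCircle))
    fun _ => QuotientAddGroup.isOpenQuotientMap_mk).isQuotientMap

/-- The fundamental group of a space homeomorphic to the torus of dimension `l` is `ℤˡ`. -/
def fundamentalGroupMulEquivOfTorus {M : Type*} [TopologicalSpace M]
    (φ : M ≃ₜ (Fin l → UnitAddCircle)) (m : M) :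
    FundamentalGroup M m ≃* Multiplicative (Fin l → ℤ) :=
  ((((isQuotientMap_torusProjection l).isAddQuotientCoveringMap_of_isDiscrete_ker_addMonoidHom
    (isDiscrete_ker_torusProjection l)).toMultiplicative.homeomorph_comp
      φ.symm).fundamentalGroupMulEquiv m).trans
    (AddEquiv.toMultiplicative (latticeEquivKer l).symm)

end Torus

/-! ### Transport to the fundamental group, and conclusion -/

namespace IsRiemannianCovering

variable {n : ℕ}
  {M : Type*} [EMetricSpace M] [ChartedSpace (EuclideanSpace ℝ (Fin n)) M]
  [IsManifold (𝓡 n) ∞ M] [RiemannianBundle (fun x : M => TangentSpace (𝓡 n) x)]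
  [IsRiemannianManifold (𝓡 n) M] [CompactSpace M] [ConnectedSpace M]
  {M' : Type*} [EMetricSpace M'] [ChartedSpace (EuclideanSpace ℝ (Fin n)) M']
  [IsManifold (𝓡 n) ∞ M'] [RiemannianBundle (fun x : M' => TangentSpace (𝓡 n) x)]
  [IsRiemannianManifold (𝓡 n) M'] [SimplyConnectedSpace M']
  {p : M' → M} (hp : IsRiemannianCovering (n := n) p)
include hp

/-- The displacement length, transported to the fundamental group of the base. -/
lemma isGeometricLength_fundamentalGroup (m : M) (x : M') :
    IsGeometricLength
      (deckLength p x ∘ hp.isQuotientCoveringMap.fundamentalGroupMulEquiv m) :=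
  (hp.isGeometricLength_deckLength x).comp_mulEquiv _

variable [IsContMDiffRiemannianBundle (𝓡 n) ∞ (EuclideanSpace ℝ (Fin n))
      (fun x : M' => TangentSpace (𝓡 n) x)] [MeasurableSpace M'] [BorelSpace M']

lemma weaklyEquivalent_volumeGrowth (m : M) {S : Set (FundamentalGroup M m)} (hfin : S.Finite)
    (hS : Subgroup.closure S = ⊤) (x : M') :
    WeaklyEquivalent (volumeGrowth n x) (natGrowth (wordGrowth S)) := by
  have hℓ := hp.isGeometricLength_fundamentalGroup m x
  have h1 := hℓ.dominated_natGrowth hS hfin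
  have h2 := hℓ.natGrowth_dominated hS hfin
  have he := lengthGrowth_comp_mulEquiv (deckLength p x)
    (hp.isQuotientCoveringMap.fundamentalGroupMulEquiv m)
  rw [he] at h1 h2
  have hmono := monotone_natGrowth (monotone_wordGrowth hS hfin)
  exact .of_growthDominated (monotone_volumeGrowth x) hmono
    ((hp.volumeGrowth_dominated x).trans hmono h1)
    (h2.trans (monotone_volumeGrowth x) (hp.dominated_volumeGrowth x))

lemma volumeDegree_eq (m : M) {S : Set (FundamentalGroup M m)} (hfin : S.Finite)
    (hS : Subgroup.closure S = ⊤) (x : M') :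
    volumeDegree n x = polynomialDegree (natGrowth (wordGrowth S)) :=
  have h := hp.weaklyEquivalent_volumeGrowth m hfin hS x
  polynomialDegree_eq_of_growthDominated
    (h.growthDominated (monotone_natGrowth (monotone_wordGrowth hS hfin)))
    (h.growthDominated' (monotone_volumeGrowth x))

end IsRiemannianCovering

lemma HasPolynomialGrowth.polynomialDegree_eq {G : Type*} [Group G] {S : Set G}
    (hfin : S.Finite) (hS : Subgroup.closure S = ⊤) {d : ℝ≥0} (h : HasPolynomialGrowth S d) :
    polynomialDegree (natGrowth (wordGrowth S)) = d := by
  rw [← polynomialDegree_rpow d]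
  exact polynomialDegree_eq_of_growthDominated (h.growthDominated (monotone_coe_rpow d))
    (h.growthDominated' (monotone_natGrowth (monotone_wordGrowth hS hfin)))

lemma hasSuperpolynomialGrowth_of_one_lt_exponentialGrowthRate {G : Type*} [Group G] {S : Set G}
    (h : 1 < exponentialGrowthRate S) : HasSuperpolynomialGrowth S := by
  intro d C
  by_contra! hC
  exact h.not_ge (limsup_rpow_inv_le_one hC)

lemma IsGeometricLength.polynomialDegree_eq {G : Type*} [Group G] {ℓ : G → ℝ≥0}
    (hℓ : IsGeometricLength ℓ) {S : Set G} (hfin : S.Finite) (hS : Subgroup.closure S = ⊤) :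
    polynomialDegree (natGrowth (wordGrowth S)) = polynomialDegree (lengthGrowth ℓ) :=
  polynomialDegree_eq_of_growthDominated (hℓ.natGrowth_dominated hS hfin)
    (hℓ.dominated_natGrowth hS hfin)

end

theorem corollary3p1 {n : ℕ}
    {M : Type*} [EMetricSpace M] [ChartedSpace (EuclideanSpace ℝ (Fin n)) M]
    [IsManifold (𝓡 n) ∞ M]
    [RiemannianBundle (fun x : M => TangentSpace (𝓡 n) x)]
    [IsContMDiffRiemannianBundle (𝓡 n) ∞ (EuclideanSpace ℝ (Fin n))
      (fun x : M => TangentSpace (𝓡 n) x)]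
    [IsRiemannianManifold (𝓡 n) M]
    [CompactSpace M] [ConnectedSpace M]
    {M' : Type*} [EMetricSpace M'] [ChartedSpace (EuclideanSpace ℝ (Fin n)) M']
    [IsManifold (𝓡 n) ∞ M']
    [RiemannianBundle (fun x : M' => TangentSpace (𝓡 n) x)]
    [IsContMDiffRiemannianBundle (𝓡 n) ∞ (EuclideanSpace ℝ (Fin n))
      (fun x : M' => TangentSpace (𝓡 n) x)]
    [IsRiemannianManifold (𝓡 n) M']
    [MeasurableSpace M'] [BorelSpace M']
    [SimplyConnectedSpace M']
    (p : M' → M) (_hp : IsRiemannianCovering (n := n) p) :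
    (∀ m : M, Group.FG (FundamentalGroup M m)) ∧
    (∀ (m : M) (S : Set (FundamentalGroup M m)), S.Finite → Subgroup.closure S = ⊤ →
      ∀ x : M',
        WeaklyEquivalent (volumeGrowth n x) (natGrowth (wordGrowth S)) ∧
        volumeDegree n x = polynomialDegree (natGrowth (wordGrowth S)) ∧
        (∀ d : ℝ≥0, HasPolynomialGrowth S d → volumeDegree n x = d) ∧
        (HasSuperpolynomialGrowth S → volumeDegree n x = ⊤) ∧
        (1 < exponentialGrowthRate S → volumeDegree n x = ⊤)) ∧
    (∀ x y : M', volumeDegree n x = volumeDegree n y) ∧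
    (∀ l : ℕ, Nonempty (M ≃ₜ (Fin l → UnitAddCircle)) →
      ∀ x : M', volumeDegree n x = l) := by
  have hfg : ∀ m : M, Group.FG (FundamentalGroup M m) := fun m => by
    obtain ⟨x⟩ := (inferInstance : Nonempty M')
    exact (_hp.isGeometricLength_fundamentalGroup m x).fg
  refine ⟨hfg, fun m S hfin hS x => ?_, fun x y => ?_, fun l ⟨φ⟩ x => ?_⟩
  · have hdeg := _hp.volumeDegree_eq m hfin hS x
    exact ⟨_hp.weaklyEquivalent_volumeGrowth m hfin hS x, hdeg,
      fun d hd => hdeg.trans (hd.polynomialDegree_eq hfin hS),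
      fun h => hdeg.trans (polynomialDegree_natGrowth_eq_top h),
      fun h => hdeg.trans (polynomialDegree_natGrowth_eq_top
        (hasSuperpolynomialGrowth_of_one_lt_exponentialGrowthRate h))⟩
  -- One group, based at `p x`, computes the degree at both points.
  · obtain ⟨S, hS, hfin⟩ := Group.fg_iff.1 (hfg (p x))
    rw [_hp.volumeDegree_eq _ hfin hS x, _hp.volumeDegree_eq _ hfin hS y]
  · obtain ⟨S, hS, hfin⟩ := Group.fg_iff.1 (hfg (p x))
    let ψ := fundamentalGroupMulEquivOfTorus l φ (p x)
    -- The lattice norm pulled back along `ψ` is another geometric length on the same group, so it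
    -- may replace the displacement.
    rw [_hp.volumeDegree_eq _ hfin hS x,
      ((isGeometricLength_latticeLength l).comp_mulEquiv ψ).polynomialDegree_eq hfin hS,
      lengthGrowth_comp_mulEquiv, polynomialDegree_latticeLength]
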